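/- Fix $\mu_0>0$ and an interface point $x_0\in\mathbb{R}$. A permittivity is a piecewise smooth function $\varepsilon:\mathbb{R}\to\mathbb{C}$ with $\mathrm{Re}\,\varepsilon>0$, $\varepsilon(x+1)=\varepsilon(x)$ for all $x$, and $\varepsilon(x_0+h)=\varepsilon(x_0+1-h)$ for $h\in(0,1)$. For such $\varepsilon$ let $\mathcal{L}_\varepsilon u=-\frac{1}{\mu_0}\big(\frac1\varepsilon u'\big)'$; solutions of $\mathcal{L}_\varepsilon u=\omega^2u$ on $\mathbb{R}$ are understood with $u$ and the flux $\frac1\varepsilon u'$ continuous. The Floquet-Bloch spectrum of $\mathcal{L}_\varepsilon$ is the set of $\omega\in\mathbb{C}$ for which $\mathcal{L}_\varepsilon u=\omega^2u$ has a solution $u\neq0$ with $u(x+1)=e^{i\kappa}u(x)$ and $u'(x+1)=e^{i\kappa}u'(x)$ for some $\kappa\in[-\pi,\pi]$; a band gap of $\mathcal{L}_\varepsilon$ is a connected component of the complement of this set in $\mathbb{C}$. For a pair of permittivities $(\varepsilon_A,\varepsilon_B)$ (material $A$ on the left of $x_0$, material $B$ on the right) and for $\omega$ in a band gap of both $\mathcal{L}_{\varepsilon_A}$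 and $\mathcal{L}_{\varepsilon_B}$, the interface impedance is $$Z(\omega)=Z_A(\omega)+Z_B(\omega),\qquad Z_A(\omega)=-\frac{u_A(x_0)}{\big(\frac{1}{\varepsilon_A}u_A'\big)(x_0^-)},\qquad Z_B(\omega)=\frac{u_B(x_0)}{\big(\frac{1}{\varepsilon_B}u_B'\big)(x_0^+)},$$ where $u_A\ne0$ (respectively $u_B\neq0$) is the solution, unique up to scaling, of $\mathcal{L}_{\varepsilon_A}u=\omega^2u$ (respectively $\mathcal{L}_{\varepsilon_B}u=\omega^2u$) that tends to $0$ together with its derivative as $x\to-\infty$ (respectively $x\to+\infty$). A root of $Z$ is an $\omega$ in a band gap of both operators at which neither $Z_A$ nor $Z_B$ has a pole (i.e. both denominators are non-zero) and $Z(\omega)=0$. Let $(\varepsilon_A^{(D_1)},\varepsilon_B^{(D_1)})$ be a pair of permittivities, and for every $\delta>0$ let $(\varepsilon_A^{(D_2)},\varepsilon_B^{(D_2)})=(\varepsilon_A^{(D_2)}(\delta),\varepsilon_B^{(D_2)}(\delta))$ be a pair of permittivities with the same real parts, $\mathrm{Re}\,\varepsilon_j^{(D_2)}(\delta)=\mathrm{Re}\,\varepsilon_j^{(D_1)}$,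 such that $$\lim_{\delta\to0}\ \sup_{x\in\mathbb{R}}\Big|\mathrm{Im}\,\varepsilon^{(D_2)}_j(\delta)(x)-\mathrm{Im}\,\varepsilon^{(D_1)}_j(x)\Big|=0,\qquad j=A,B.$$ Let $Z^{(D_1)}$ and $Z^{(D_2)}$ be the associated interface impedances. Let $\mathfrak{A}^{D_1}=\mathfrak{A}_A\cap\mathfrak{A}_B$, where $\mathfrak{A}_j$ is a band gap of $\mathcal{L}_{\varepsilon_j^{(D_1)}}$, and let $\omega_1\in\mathfrak{A}^{D_1}$ be a root of $Z^{(D_1)}$ such that $Z^{(D_1)}$ does not vanish identically in a neighbourhood of $\omega_1$. Then there is $\delta_0>0$ such that for every $\delta\in(0,\delta_0)$ the impedance $Z^{(D_2)}$ has a root $\omega_2(\delta)$, lying in $\mathfrak{A}^{D_1}$ and in band gaps of both $\mathcal{L}_{\varepsilon_A^{(D_2)}(\delta)}$ and $\mathcal{L}_{\varepsilon_B^{(D_2)}(\delta)}$, and $\omega_2(\delta)\to\omega_1$ as $\delta\to0$. -/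

import Mathlib

open Set Filter Topology

/-- `f` is piecewise smooth: away from a locally finite set of break points, it agrees on every
bounded interval with a function that is smooth up to (and beyond) the end points. -/
def IsPiecewiseSmooth (f : ℝ → ℂ) : Prop :=
  ∃ S : Set ℝ, (∀ a b : ℝ, (S ∩ Icc a b).Finite) ∧
    ∀ a b : ℝ, a < b → Disjoint S (Ioo a b) →
      ∃ g : ℝ → ℂ, ContDiff ℝ (⊤ : ℕ∞) g ∧ EqOn f g (Ioo a b)

/-- Standing assumptions on the (complex) permittivity of one material whose unit cells have the
end points `x₀ + n`, `n ∈ ℤ`. -/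
structure IsPermittivity (x₀ : ℝ) (ε : ℝ → ℂ) : Prop where
  piecewiseSmooth : IsPiecewiseSmooth ε
  re_pos : ∀ x, 0 < (ε x).re
  periodic : ∀ x, ε (x + 1) = ε x
  inversionSymmetric : ∀ h ∈ Ioo (0 : ℝ) 1, ε (x₀ + h) = ε (x₀ + 1 - h)

/-- `u` solves `-(1/μ₀) ((1/ε) u')' = ω² u` on the real line, and `v` is its flux `(1/ε) u'`.
As usual for a discontinuous coefficient, `u` and the flux are continuous, so they match across
the jumps of `ε`; `u' = ε v` holds at the points where `ε` is continuous. -/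
structure IsSolution (μ₀ : ℝ) (ε : ℝ → ℂ) (ω : ℂ) (u v : ℝ → ℂ) : Prop where
  continuous : Continuous u
  flux_continuous : Continuous v
  hasDerivAt : ∀ x, ContinuousAt ε x → HasDerivAt u (ε x * v x) x
  flux_hasDerivAt : ∀ x, HasDerivAt v (-((μ₀ : ℂ) * ω ^ 2 * u x)) x

/-- The Floquet-Bloch spectrum, in terms of the frequency `ω`: there is a non-zero quasiperiodic
solution with a real quasimomentum `κ`. By periodicity of `ε`, quasiperiodicity of `u'` is that of
the flux. -/
def blochSpectrum (μ₀ : ℝ) (ε : ℝ → ℂ) : Set ℂ :=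
  {ω | ∃ κ ∈ Icc (-Real.pi) Real.pi, ∃ u v : ℝ → ℂ, IsSolution μ₀ ε ω u v ∧ u ≠ 0 ∧
    (∀ x, u (x + 1) = Complex.exp (Complex.I * κ) * u x) ∧
    (∀ x, v (x + 1) = Complex.exp (Complex.I * κ) * v x)}

/-- A band gap: a connected component of the complement of the Floquet-Bloch spectrum in `ℂ`. -/
def IsBandGap (μ₀ : ℝ) (ε : ℝ → ℂ) (G : Set ℂ) : Prop :=
  ∃ ω ∈ (blochSpectrum μ₀ ε)ᶜ, G = connectedComponentIn (blochSpectrum μ₀ ε)ᶜ ω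

/-- `u` is a non-zero solution, with flux `v`, that decays together with its derivative `u' = ε v`
along the filter `l` (`atBot` for the left material, `atTop` for the right one). -/
structure IsDecayingSolution (μ₀ : ℝ) (ε : ℝ → ℂ) (ω : ℂ) (l : Filter ℝ) (u v : ℝ → ℂ) :
    Prop where
  isSolution : IsSolution μ₀ ε ω u v
  ne_zero : u ≠ 0
  tendsto : Tendsto u l (𝓝 0)
  deriv_tendsto : Tendsto (fun x => ε x * v x) l (𝓝 0)

open Classical in
/-- The quotient `u(x₀) / ((1/ε) u')(x₀)` for a solution `u` that decays along `l`. For `ω` in a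
band gap such a solution is unique up to scaling. The value is only meaningful if
`HasFiniteImpedance` holds. -/
noncomputable def decayingRatio (μ₀ x₀ : ℝ) (ε : ℝ → ℂ) (l : Filter ℝ) (ω : ℂ) : ℂ :=
  if h : ∃ p : (ℝ → ℂ) × (ℝ → ℂ), IsDecayingSolution μ₀ ε ω l p.1 p.2 then
    h.choose.1 x₀ / h.choose.2 x₀
  else 0

/-- The surface impedance has no pole at `ω`: there is a solution that decays along `l`, and the
flux at `x₀` of every such solution is non-zero. -/
def HasFiniteImpedance (μ₀ x₀ : ℝ) (ε : ℝ → ℂ) (l : Filter ℝ) (ω : ℂ) : Prop :=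
  (∃ u v : ℝ → ℂ, IsDecayingSolution μ₀ ε ω l u v) ∧
    ∀ u v : ℝ → ℂ, IsDecayingSolution μ₀ ε ω l u v → v x₀ ≠ 0

/-- Surface impedance `Z_A` of the material on the left of `x₀`. -/
noncomputable def surfaceImpedanceA (μ₀ x₀ : ℝ) (εA : ℝ → ℂ) (ω : ℂ) : ℂ :=
  -decayingRatio μ₀ x₀ εA atBot ω

/-- Surface impedance `Z_B` of the material on the right of `x₀`. -/
noncomputable def surfaceImpedanceB (μ₀ x₀ : ℝ) (εB : ℝ → ℂ) (ω : ℂ) : ℂ :=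
  decayingRatio μ₀ x₀ εB atTop ω

/-- Interface impedance `Z = Z_A + Z_B`. -/
noncomputable def interfaceImpedance (μ₀ x₀ : ℝ) (εA εB : ℝ → ℂ) (ω : ℂ) : ℂ :=
  surfaceImpedanceA μ₀ x₀ εA ω + surfaceImpedanceB μ₀ x₀ εB ω

/-- `ω` is a root of the interface impedance `Z`: it lies in a band gap of both materials (where
`Z` is defined), neither surface impedance has a pole there, and `Z ω = 0`. -/
structure IsImpedanceRoot (μ₀ x₀ : ℝ) (εA εB : ℝ → ℂ) (ω : ℂ) : Prop where
  gapA : ω ∉ blochSpectrum μ₀ εA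
  gapB : ω ∉ blochSpectrum μ₀ εB
  finiteA : HasFiniteImpedance μ₀ x₀ εA atBot ω
  finiteB : HasFiniteImpedance μ₀ x₀ εB atTop ω
  eq_zero : interfaceImpedance μ₀ x₀ εA εB ω = 0

/-! Put z = μ₀ω² and write the equation as the system u' = εv, v' = -zu. The solution with given
data at x₀ is a power series in z whose coefficients are iterated Volterra integrals bounded by A
C^k / k!. It is therefore entire in z, and by dominated convergence it depends continuously on ε and
z jointly, as long as the coefficients are uniformly bounded and converge pointwise.

Let M be the monodromy matrix over one period. The Wronskian is constant, so det M = 1, and ω lies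
in the Bloch spectrum exactly when the trace D of M lies in [-2, 2]
(`IsPermittivity.mem_blochSpectrum_iff`). Off this segment the eigenvalues ρ and σ = 1/ρ of M are
holomorphic functions of D, and exactly one has modulus less than one. Name them so that ρ belongs
to the solutions decaying at the given end. By Cayley–Hamilton, M - σ maps any data (c₁, c₂) into
the ρ-eigenline, so the impedance is, up to sign, the quotient of the two entries of (M - σ)(c₁, c₂)
whenever the second is non-zero (`IsPermittivity.impedance_of_floquetV_ne_zero`).

This explicit quotient gives everything that is needed. Near ω₁ the impedance of the first system is
finite and holomorphic, and the perturbed impedances are finite, holomorphic and convergent as (δ,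
ω) tends to (0, w), for each w near ω₁ (`IsPermittivity.perturbation`). Since ω₁ is an isolated
zero, a Hurwitz argument (`eventually_exists_zero_of_tendsto`) yields zeros of the perturbed
impedances in every disc around ω₁ for small δ. Small discs stay inside the open band gaps, and an
almost closest root for each δ gives the convergent family. -/

open MeasureTheory Interval

/-! ### Permittivities as bounded measurable coefficients -/

/-- A bounded measurable coefficient that is continuous off a countable set. -/
structure IsBoundedCoefficient (B : ℝ) (ε : ℝ → ℂ) : Prop where
  aestronglyMeasurable : AEStronglyMeasurable ε volume
  norm_le : ∀ x, ‖ε x‖ ≤ B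
  countable : {x | ¬ContinuousAt ε x}.Countable

theorem IsPiecewiseSmooth.countable_not_continuousAt {f : ℝ → ℂ} (hf : IsPiecewiseSmooth f) :
    {x | ¬ContinuousAt f x}.Countable := by
  obtain ⟨S, hS, hg⟩ := hf
  have hSc : S.Countable := by
    have : S ⊆ ⋃ n : ℕ, S ∩ Icc (-(n : ℝ)) n := by
      intro x hx
      obtain ⟨n, hn⟩ := exists_nat_ge |x|
      exact mem_iUnion.2 ⟨n, hx, abs_le.1 hn⟩
    exact (countable_iUnion fun n : ℕ => (hS (-(n : ℝ)) n).countable).mono this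
  refine hSc.mono fun x hx => ?_
  by_contra hxS
  apply hx
  have h1 : (S ∩ Icc (x - 1) (x + 1))ᶜ ∈ 𝓝 x :=
    (hS (x - 1) (x + 1)).isClosed.isOpen_compl.mem_nhds fun h => hxS h.1
  have h2 : Ioo (x - 1) (x + 1) ∈ 𝓝 x := Ioo_mem_nhds (by linarith) (by linarith)
  obtain ⟨a, b, hab, hsub⟩ := mem_nhds_iff_exists_Ioo_subset.1 (inter_mem h1 h2)
  obtain ⟨g, hgc, hgeq⟩ := hg a b (hab.1.trans hab.2) (by
    rw [Set.disjoint_left]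
    intro y hyS hy
    exact (hsub hy).1 ⟨hyS, Ioo_subset_Icc_self (hsub hy).2⟩)
  refine (hgc.continuous.continuousAt (x := x)).congr ?_
  filter_upwards [Ioo_mem_nhds hab.1 hab.2] with y hy using (hgeq hy).symm

theorem aestronglyMeasurable_of_countable_not_continuousAt {f : ℝ → ℂ}
    (hf : {x | ¬ContinuousAt f x}.Countable) : AEStronglyMeasurable f volume := by
  have hm : MeasurableSet {x | ¬ContinuousAt f x}ᶜ := hf.measurableSet.compl
  have h1 : ContinuousOn f {x | ¬ContinuousAt f x}ᶜ := fun x hx =>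
    ContinuousAt.continuousWithinAt (not_not.1 hx)
  have h2 := h1.aestronglyMeasurable (μ := volume) hm
  rwa [Measure.restrict_eq_self_of_ae_mem] at h2
  exact hf.ae_notMem volume

/-- Since `x` may be a break point, its two sides are treated separately. On each side the smooth
function is defined beyond the end points, hence bounded on the closed interval. -/
theorem IsPiecewiseSmooth.exists_bound_nhds {f : ℝ → ℂ} (hf : IsPiecewiseSmooth f) (x : ℝ) :
    ∃ t ∈ 𝓝 x, ∃ B, ∀ y ∈ t, ‖f y‖ ≤ B := by
  obtain ⟨S, hS, hg⟩ := hf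
  have h1 : ((S \ {x}) ∩ Icc (x - 1) (x + 1))ᶜ ∈ 𝓝 x := by
    refine IsOpen.mem_nhds (Set.Finite.isClosed ?_).isOpen_compl fun h => h.1.2 rfl
    exact (hS (x - 1) (x + 1)).subset (inter_subset_inter_left _ sdiff_subset)
  have h2 : Ioo (x - 1) (x + 1) ∈ 𝓝 x := Ioo_mem_nhds (by linarith) (by linarith)
  obtain ⟨a, b, hab, hsub⟩ := mem_nhds_iff_exists_Ioo_subset.1 (inter_mem h1 h2)
  have key : ∀ c d : ℝ, c < d → a ≤ c → d ≤ b → x ∉ Ioo c d →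
      ∃ B, ∀ y ∈ Ioo c d, ‖f y‖ ≤ B := by
    intro c d hcd hac hdb hx
    obtain ⟨g, hgc, hgeq⟩ := hg c d hcd (by
      rw [Set.disjoint_left]
      intro y hyS hy
      have hy' := hsub (Ioo_subset_Ioo hac hdb hy)
      exact hy'.1 ⟨⟨hyS, fun h => hx (by rw [mem_singleton_iff] at h; rwa [← h])⟩,
        Ioo_subset_Icc_self hy'.2⟩)
    obtain ⟨B, hB⟩ := (isCompact_Icc (a := c) (b := d)).exists_bound_of_continuousOn
      hgc.continuous.continuousOn
    exact ⟨B, fun y hy => by rw [hgeq hy]; exact hB y (Ioo_subset_Icc_self hy)⟩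
  obtain ⟨B₁, hB₁⟩ := key a x hab.1 le_rfl hab.2.le (by simp)
  obtain ⟨B₂, hB₂⟩ := key x b hab.2 hab.1.le le_rfl (by simp)
  refine ⟨Ioo a b, Ioo_mem_nhds hab.1 hab.2, max (max B₁ B₂) ‖f x‖, fun y hy => ?_⟩
  rcases lt_trichotomy y x with h | h | h
  · exact (hB₁ y ⟨hy.1, h⟩).trans ((le_max_left _ _).trans (le_max_left _ _))
  · rw [h]; exact le_max_right _ _
  · exact (hB₂ y ⟨h, hy.2⟩).trans ((le_max_right _ _).trans (le_max_left _ _))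

theorem IsPiecewiseSmooth.exists_bound_of_periodic {f : ℝ → ℂ} (hf : IsPiecewiseSmooth f)
    (hp : ∀ x, f (x + 1) = f x) : ∃ B, ∀ x, ‖f x‖ ≤ B := by
  obtain ⟨B, hB⟩ : ∃ B, ∀ y ∈ Icc (0 : ℝ) 1, ‖f y‖ ≤ B := by
    refine (isCompact_Icc (a := (0 : ℝ)) (b := 1)).induction_on
      (p := fun s => ∃ B, ∀ y ∈ s, ‖f y‖ ≤ B) ⟨0, by simp⟩ ?_ ?_ ?_
    · rintro s t hst ⟨B, hB⟩
      exact ⟨B, fun y hy => hB y (hst hy)⟩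
    · rintro s t ⟨B, hB⟩ ⟨C, hC⟩
      refine ⟨max B C, fun y hy => ?_⟩
      rcases hy with hy | hy
      · exact (hB y hy).trans (le_max_left _ _)
      · exact (hC y hy).trans (le_max_right _ _)
    · intro x _
      obtain ⟨t, ht, h⟩ := hf.exists_bound_nhds x
      exact ⟨t, mem_nhdsWithin_of_mem_nhds ht, h⟩
  refine ⟨B, fun x => ?_⟩
  have hper : Function.Periodic f 1 := hp
  obtain ⟨y, hy, hxy⟩ := hper.exists_mem_Ico₀ one_pos x
  rw [hxy]
  exact hB y (Ico_subset_Icc_self hy)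

theorem IsPermittivity.exists_isBoundedCoefficient {x₀ : ℝ} {ε : ℝ → ℂ}
    (h : IsPermittivity x₀ ε) : ∃ B, IsBoundedCoefficient B ε := by
  obtain ⟨B, hB⟩ := h.piecewiseSmooth.exists_bound_of_periodic h.periodic
  have hc := h.piecewiseSmooth.countable_not_continuousAt
  exact ⟨B, aestronglyMeasurable_of_countable_not_continuousAt hc, hB, hc⟩

/-! ### Factorial bounds for iterated Volterra integrals -/

section Volterra

variable {B x₀ : ℝ} {ε : ℝ → ℂ}

theorem IsBoundedCoefficient.nonneg (h : IsBoundedCoefficient B ε) : 0 ≤ B :=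
  (norm_nonneg _).trans (h.norm_le 0)

theorem IsBoundedCoefficient.intervalIntegrable_mul (h : IsBoundedCoefficient B ε)
    {f : ℝ → ℂ} (hf : Continuous f) (a b : ℝ) :
    IntervalIntegrable (fun t => ε t * f t) volume a b := by
  have h1 : IntervalIntegrable ε volume a b := by
    refine (intervalIntegrable_const (c := B)).mono_fun h.aestronglyMeasurable.restrict ?_
    filter_upwards with x
    rw [Real.norm_of_nonneg h.nonneg]
    exact h.norm_le x
  exact h1.mul_continuousOn hf.continuousOn

/-- The twofold Volterra integral `∫ ε ∫ f` from the base point `x₀`. -/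
noncomputable def volterra (x₀ : ℝ) (ε : ℝ → ℂ) (f : ℝ → ℂ) (x : ℝ) : ℂ :=
  ∫ t in x₀..x, ε t * ∫ s in x₀..t, f s

theorem continuous_integral_of_continuous {f : ℝ → ℂ} (hf : Continuous f) :
    Continuous fun x => ∫ t in x₀..x, f t :=
  intervalIntegral.continuous_primitive (fun a b => hf.intervalIntegrable a b) x₀

theorem IsBoundedCoefficient.continuous_integral_mul (h : IsBoundedCoefficient B ε)
    {f : ℝ → ℂ} (hf : Continuous f) : Continuous fun x => ∫ t in x₀..x, ε t * f t :=
  intervalIntegral.continuous_primitive (fun a b => h.intervalIntegrable_mul hf a b) x₀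

theorem IsBoundedCoefficient.continuous_volterra (h : IsBoundedCoefficient B ε)
    {f : ℝ → ℂ} (hf : Continuous f) : Continuous (volterra x₀ ε f) :=
  h.continuous_integral_mul (continuous_integral_of_continuous hf)

theorem IsBoundedCoefficient.continuous_volterra_iterate (h : IsBoundedCoefficient B ε)
    {f : ℝ → ℂ} (hf : Continuous f) (k : ℕ) : Continuous ((volterra x₀ ε)^[k] f) := by
  induction k with
  | zero => exact hf
  | succ k ih => rw [Function.iterate_succ_apply']; exact h.continuous_volterra ih

theorem abs_sub_le_of_mem_uIoc {a b t : ℝ} (ht : t ∈ Ι a b) : |t - a| ≤ |b - a| := by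
  rcases mem_uIoc.1 ht with h | h
  · rw [abs_of_nonneg (by linarith), abs_of_nonneg (by linarith)]; linarith
  · rw [abs_of_nonpos (by linarith), abs_of_nonpos (by linarith)]; linarith

theorem norm_integral_le_of_pow_bound {f : ℝ → ℂ} {A C : ℝ} {k : ℕ} {x : ℝ}
    (hf : ∀ t ∈ Ι x₀ x, ‖f t‖ ≤ A * (C * |t - x₀|) ^ k / k.factorial) :
    ‖∫ t in x₀..x, f t‖ ≤ A * C ^ k * |x - x₀| ^ (k + 1) / (k + 1).factorial := by
  rw [intervalIntegral.norm_integral_eq_norm_integral_uIoc]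
  have h1 : ‖∫ t in Ι x₀ x, f t‖ ≤ ∫ t in Ι x₀ x, A * C ^ k / k.factorial * |t - x₀| ^ k := by
    refine MeasureTheory.norm_integral_le_of_norm_le ?_ ?_
    · have : Continuous fun t : ℝ => A * C ^ k / k.factorial * |t - x₀| ^ k := by fun_prop
      exact (this.intervalIntegrable x₀ x).def'
    · refine (ae_restrict_iff' measurableSet_uIoc).2 (ae_of_all _ fun t ht => ?_)
      refine (hf t ht).trans (le_of_eq ?_)
      rw [mul_pow]; ring
  refine h1.trans (le_of_eq ?_)
  rw [integral_const_mul, integral_pow_abs_sub_uIoc, Nat.factorial_succ]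
  push_cast
  field_simp

/-- Of the two integrations in each step, the inner one is carried out exactly and produces the
factorial. The outer one is only estimated by B times the length of the interval, which is at most
R. -/
theorem IsBoundedCoefficient.norm_volterra_iterate_le (h : IsBoundedCoefficient B ε)
    {f : ℝ → ℂ} {R A : ℝ} (hA : ∀ x, |x - x₀| ≤ R → ‖f x‖ ≤ A) (k : ℕ) :
    ∀ x, |x - x₀| ≤ R →
      ‖(volterra x₀ ε)^[k] f x‖ ≤ A * (B * R * |x - x₀|) ^ k / k.factorial := by
  induction k with
  | zero => intro x hx; simpa using hA x hx
  | succ k ih =>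
    intro x hx
    have hB := h.nonneg
    have hR : 0 ≤ R := (abs_nonneg _).trans hx
    have hA0 : 0 ≤ A := (norm_nonneg _).trans (hA x hx)
    rw [Function.iterate_succ_apply']
    have h1 : ∀ t ∈ Ι x₀ x, ‖ε t * ∫ s in x₀..t, (volterra x₀ ε)^[k] f s‖ ≤
        B * (A * (B * R) ^ k * |x - x₀| ^ (k + 1) / (k + 1).factorial) := by
      intro t ht
      have htx := abs_sub_le_of_mem_uIoc ht
      rw [norm_mul]
      refine mul_le_mul (h.norm_le t) ?_ (norm_nonneg _) hB
      refine (norm_integral_le_of_pow_bound fun s hs =>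
        ih s ((abs_sub_le_of_mem_uIoc hs).trans (htx.trans hx))).trans ?_
      gcongr
    refine (intervalIntegral.norm_integral_le_of_norm_le_const h1).trans ?_
    calc _ ≤ B * (A * (B * R) ^ k * |x - x₀| ^ (k + 1) / (k + 1).factorial) * R := by gcongr
      _ = _ := by rw [mul_pow]; ring

theorem IsBoundedCoefficient.norm_integral_volterra_iterate_le (h : IsBoundedCoefficient B ε)
    {f : ℝ → ℂ} {R A : ℝ} (hA : ∀ x, |x - x₀| ≤ R → ‖f x‖ ≤ A) (k : ℕ) {x : ℝ}
    (hx : |x - x₀| ≤ R) :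
    ‖∫ t in x₀..x, (volterra x₀ ε)^[k] f t‖ ≤ A * R * (B * R * R) ^ k / k.factorial := by
  have hB := h.nonneg
  have hR : 0 ≤ R := (abs_nonneg _).trans hx
  have hA0 : 0 ≤ A := (norm_nonneg _).trans (hA x hx)
  have h1 : ∀ t ∈ Ι x₀ x, ‖(volterra x₀ ε)^[k] f t‖ ≤ A * (B * R * R) ^ k / k.factorial := by
    intro t ht
    have htR := (abs_sub_le_of_mem_uIoc ht).trans hx
    refine (h.norm_volterra_iterate_le hA k t htR).trans ?_
    gcongr
  refine (intervalIntegral.norm_integral_le_of_norm_le_const h1).trans ?_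
  calc _ ≤ A * (B * R * R) ^ k / k.factorial * R := by gcongr
    _ = _ := by ring

end Volterra

/-! ### Power series with exponentially small coefficients -/

section ExponentialSeries

variable {α : ℕ → ℂ} {A C : ℝ}

theorem norm_neg_pow_mul_le (hα : ∀ k, ‖α k‖ ≤ A * C ^ k / k.factorial) {z : ℂ} {ρ : ℝ}
    (hz : ‖z‖ ≤ ρ) (k : ℕ) : ‖(-z) ^ k * α k‖ ≤ A * ((ρ * C) ^ k / k.factorial) := by
  have hρ := (norm_nonneg z).trans hz
  rw [norm_mul, norm_pow, norm_neg]
  calc _ ≤ ρ ^ k * (A * C ^ k / k.factorial) :=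
        mul_le_mul (pow_le_pow_left₀ (norm_nonneg _) hz k) (hα k) (norm_nonneg _)
          (pow_nonneg hρ k)
    _ = _ := by rw [mul_pow]; ring

theorem summable_exponential_bound (A C : ℝ) :
    Summable fun k : ℕ => A * (C ^ k / k.factorial) :=
  (Real.summable_pow_div_factorial C).mul_left A

/-- On each ball the factorial bound gives a summable majorant independent of z, so the Weierstrass
theorem on series of holomorphic functions applies. -/
theorem differentiable_tsum_neg_pow_mul (hα : ∀ k, ‖α k‖ ≤ A * C ^ k / k.factorial) :
    Differentiable ℂ fun z : ℂ => ∑' k, (-z) ^ k * α k := by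
  intro z
  have h := Complex.differentiableOn_tsum_of_summable_norm
    (F := fun k (w : ℂ) => (-w) ^ k * α k) (U := Metric.ball 0 (‖z‖ + 1))
    (summable_exponential_bound A ((‖z‖ + 1) * C))
    (fun k => by fun_prop) Metric.isOpen_ball
    (fun k w hw => norm_neg_pow_mul_le hα (by simpa using (mem_ball_zero_iff.1 hw).le) k)
  exact h.differentiableAt (Metric.isOpen_ball.mem_nhds (by simp))

theorem tendsto_tsum_neg_pow_mul {ι : Type*} {F : Filter ι} {a : ι → ℕ → ℂ} {w : ι → ℂ} {z : ℂ}
    (ha : ∀ k, Tendsto (fun i => a i k) F (𝓝 (α k)))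
    (hb : ∀ᶠ i in F, ∀ k, ‖a i k‖ ≤ A * C ^ k / k.factorial) (hw : Tendsto w F (𝓝 z)) :
    Tendsto (fun i => ∑' k, (-w i) ^ k * a i k) F (𝓝 (∑' k, (-z) ^ k * α k)) := by
  refine tendsto_tsum_of_dominated_convergence
    (summable_exponential_bound A ((‖z‖ + 1) * C)) (fun k => (hw.neg.pow k).mul (ha k)) ?_
  filter_upwards [hb, hw.norm.eventually (eventually_le_nhds (lt_add_one ‖z‖))] with i hi hi' k
  exact norm_neg_pow_mul_le hi hi' k

end ExponentialSeries

/-! ### Existence, uniqueness and analyticity of solutions -/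

/-- The integrated form of the system `u' = ε v`, `v' = -z u`. -/
structure IsVolterraSolution (x₀ : ℝ) (ε : ℝ → ℂ) (z : ℂ) (u v : ℝ → ℂ) : Prop where
  continuous : Continuous u
  flux_continuous : Continuous v
  integral_eq : ∀ x, u x = u x₀ + ∫ t in x₀..x, ε t * v t
  flux_integral_eq : ∀ x, v x = v x₀ - z * ∫ t in x₀..x, u t

section Solutions

variable {B x₀ : ℝ} {ε : ℝ → ℂ}

/-- Both directions are the fundamental theorem of calculus. The converse uses its version with a
countable exceptional set, here the discontinuities of ε. -/
theorem IsBoundedCoefficient.isVolterraSolution_iff (h : IsBoundedCoefficient B ε) {μ₀ : ℝ}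
    {ω : ℂ} {u v : ℝ → ℂ} :
    IsVolterraSolution x₀ ε (μ₀ * ω ^ 2) u v ↔ IsSolution μ₀ ε ω u v := by
  constructor
  · intro hs
    refine ⟨hs.continuous, hs.flux_continuous, fun x hx => ?_, fun x => ?_⟩
    · have h1 : HasDerivAt (fun y => ∫ t in x₀..y, ε t * v t) (ε x * v x) x :=
        intervalIntegral.integral_hasDerivAt_right (h.intervalIntegrable_mul hs.flux_continuous _ _)
          (h.aestronglyMeasurable.mul
            hs.flux_continuous.aestronglyMeasurable).stronglyMeasurableAtFilter
          (hx.mul hs.flux_continuous.continuousAt)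
      rw [funext hs.integral_eq]
      exact h1.const_add (u x₀)
    · have h1 : HasDerivAt (fun y => ∫ t in x₀..y, u t) (u x) x :=
        hs.continuous.integral_hasStrictDerivAt x₀ x |>.hasDerivAt
      rw [funext hs.flux_integral_eq]
      exact (h1.const_mul _).const_sub (v x₀)
  · intro hs
    refine ⟨hs.continuous, hs.flux_continuous, fun x => ?_, fun x => ?_⟩
    · rw [MeasureTheory.integral_eq_of_hasDerivAt_off_countable u (fun t => ε t * v t) h.countable
        hs.continuous.continuousOn (fun t ht => hs.hasDerivAt t (not_not.1 ht.2))
        (h.intervalIntegrable_mul hs.flux_continuous _ _)]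
      ring
    · have h1 := intervalIntegral.integral_eq_sub_of_hasDerivAt (a := x₀) (b := x)
        (fun t _ => hs.flux_hasDerivAt t)
        ((by have := hs.continuous; fun_prop : Continuous fun t =>
          -((μ₀ : ℂ) * ω ^ 2 * u t)).intervalIntegrable _ _)
      rw [intervalIntegral.integral_neg, intervalIntegral.integral_const_mul] at h1
      linear_combination -h1

/-- With zero data, u is a fixed point of -z times the Volterra operator, hence of every power of
it, and the factorial bound sends these powers to zero. -/
theorem IsVolterraSolution.eq_zero (h : IsBoundedCoefficient B ε) {z : ℂ} {u v : ℝ → ℂ}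
    (hs : IsVolterraSolution x₀ ε z u v) (hu : u x₀ = 0) (hv : v x₀ = 0) : u = 0 ∧ v = 0 := by
  have h1 : volterra x₀ ε ((-z) • u) = u := by
    funext x
    rw [hs.integral_eq x, hu, zero_add]
    unfold volterra
    refine intervalIntegral.integral_congr fun t _ => ?_
    simp only [Pi.smul_apply, smul_eq_mul, intervalIntegral.integral_const_mul]
    rw [hs.flux_integral_eq t, hv]
    ring
  have hsmul : ∀ (c : ℂ) (f : ℝ → ℂ), volterra x₀ ε (c • f) = c • volterra x₀ ε f := by
    intro c f
    funext x
    simp only [volterra, Pi.smul_apply, smul_eq_mul, intervalIntegral.integral_const_mul]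
    rw [← intervalIntegral.integral_const_mul]
    exact intervalIntegral.integral_congr fun t _ => by ring
  rw [hsmul] at h1
  have h2 : ∀ k : ℕ, (-z) ^ k • (volterra x₀ ε)^[k] u = u := by
    intro k
    induction k with
    | zero => simp
    | succ k ih =>
      rw [Function.iterate_succ_apply', pow_succ', mul_smul, ← hsmul, ih, h1]
  have hu0 : u = 0 := by
    funext x
    obtain ⟨A, hA⟩ := (isCompact_closedBall x₀ |x - x₀|).exists_bound_of_continuousOn
      hs.continuous.continuousOn
    have hA' : ∀ y, |y - x₀| ≤ |x - x₀| → ‖u y‖ ≤ A := fun y hy => hA y hy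
    have h3 : ∀ k : ℕ, ‖u x‖ ≤
        A * ((‖z‖ * (B * |x - x₀| * |x - x₀|)) ^ k / k.factorial) := by
      intro k
      rw [← h2 k]
      have hk := h.norm_volterra_iterate_le hA' k x le_rfl
      simp only [Pi.smul_apply, smul_eq_mul, norm_mul, norm_pow, norm_neg]
      calc _ ≤ ‖z‖ ^ k * (A * (B * |x - x₀| * |x - x₀|) ^ k / k.factorial) := by gcongr
        _ = _ := by rw [mul_pow ‖z‖]; ring
    have h4 := (FloorSemiring.tendsto_pow_div_factorial_atTop
      (‖z‖ * (B * |x - x₀| * |x - x₀|))).const_mul A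
    rw [mul_zero] at h4
    exact norm_le_zero_iff.1 (ge_of_tendsto' h4 h3)
  refine ⟨hu0, ?_⟩
  funext x
  rw [hs.flux_integral_eq x, hv, hu0]
  simp

/-- The leading term of the series for the solution with data `(c₁, c₂)` at `x₀`. -/
noncomputable def leadingTerm (x₀ : ℝ) (ε : ℝ → ℂ) (c₁ c₂ : ℂ) (x : ℝ) : ℂ :=
  c₁ + ∫ t in x₀..x, ε t * c₂

/-- The solution with data `(c₁, c₂)` at `x₀`. -/
noncomputable def fundamentalU (x₀ : ℝ) (ε : ℝ → ℂ) (c₁ c₂ z : ℂ) (x : ℝ) : ℂ :=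
  ∑' k, (-z) ^ k * (volterra x₀ ε)^[k] (leadingTerm x₀ ε c₁ c₂) x

/-- The flux of the solution with data `(c₁, c₂)` at `x₀`. -/
noncomputable def fundamentalV (x₀ : ℝ) (ε : ℝ → ℂ) (c₁ c₂ z : ℂ) (x : ℝ) : ℂ :=
  c₂ - z * ∑' k, (-z) ^ k * ∫ t in x₀..x, (volterra x₀ ε)^[k] (leadingTerm x₀ ε c₁ c₂) t

theorem IsBoundedCoefficient.continuous_leadingTerm (h : IsBoundedCoefficient B ε) (c₁ c₂ : ℂ) :
    Continuous (leadingTerm x₀ ε c₁ c₂) :=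
  continuous_const.add (h.continuous_integral_mul continuous_const)

theorem IsBoundedCoefficient.norm_leadingTerm_le (h : IsBoundedCoefficient B ε) (c₁ c₂ : ℂ)
    (R x : ℝ) (hx : |x - x₀| ≤ R) : ‖leadingTerm x₀ ε c₁ c₂ x‖ ≤ ‖c₁‖ + B * ‖c₂‖ * R := by
  have hB := h.nonneg
  refine (norm_add_le _ _).trans (add_le_add_right ?_ _)
  refine (intervalIntegral.norm_integral_le_of_norm_le_const (C := B * ‖c₂‖) fun t _ => ?_).trans ?_
  · rw [norm_mul]
    exact mul_le_mul_of_nonneg_right (h.norm_le t) (norm_nonneg _)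
  · gcongr

theorem IsBoundedCoefficient.norm_iterate_leadingTerm_le (h : IsBoundedCoefficient B ε)
    (c₁ c₂ : ℂ) {R x : ℝ} (hx : |x - x₀| ≤ R) (k : ℕ) :
    ‖(volterra x₀ ε)^[k] (leadingTerm x₀ ε c₁ c₂) x‖ ≤
      (‖c₁‖ + B * ‖c₂‖ * R) * (B * R * R) ^ k / k.factorial := by
  have hB := h.nonneg
  have hR : 0 ≤ R := (abs_nonneg _).trans hx
  refine (h.norm_volterra_iterate_le (h.norm_leadingTerm_le c₁ c₂ R) k x hx).trans ?_
  gcongr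

theorem IsBoundedCoefficient.hasSum_fundamentalU (h : IsBoundedCoefficient B ε) (c₁ c₂ z : ℂ)
    (x : ℝ) : HasSum (fun k => (-z) ^ k * (volterra x₀ ε)^[k] (leadingTerm x₀ ε c₁ c₂) x)
      (fundamentalU x₀ ε c₁ c₂ z x) :=
  (Summable.of_norm_bounded (summable_exponential_bound _ _) (norm_neg_pow_mul_le
    (h.norm_iterate_leadingTerm_le c₁ c₂ (le_refl |x - x₀|)) le_rfl)).hasSum

theorem IsBoundedCoefficient.hasSum_integral_fundamentalU (h : IsBoundedCoefficient B ε)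
    (c₁ c₂ z : ℂ) (x : ℝ) :
    HasSum (fun k => (-z) ^ k * ∫ t in x₀..x, (volterra x₀ ε)^[k] (leadingTerm x₀ ε c₁ c₂) t)
      (∫ t in x₀..x, fundamentalU x₀ ε c₁ c₂ z t) := by
  have h1 := intervalIntegral.hasSum_integral_of_dominated_convergence (a := x₀) (b := x)
    (μ := volume)
    (F := fun k t => (-z) ^ k * (volterra x₀ ε)^[k] (leadingTerm x₀ ε c₁ c₂) t)
    (f := fundamentalU x₀ ε c₁ c₂ z)
    (fun k _ => (‖c₁‖ + B * ‖c₂‖ * |x - x₀|) *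
      ((‖z‖ * (B * |x - x₀| * |x - x₀|)) ^ k / k.factorial))
    (fun k => ((h.continuous_volterra_iterate
      (h.continuous_leadingTerm c₁ c₂) k).const_mul _).aestronglyMeasurable)
    (fun k => ae_of_all _ fun t ht => norm_neg_pow_mul_le
      (h.norm_iterate_leadingTerm_le c₁ c₂ (abs_sub_le_of_mem_uIoc ht)) le_rfl k)
    (ae_of_all _ fun t _ => summable_exponential_bound _ _)
    intervalIntegrable_const (ae_of_all _ fun t _ => h.hasSum_fundamentalU c₁ c₂ z t)
  simpa only [intervalIntegral.integral_const_mul] using h1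

theorem IsBoundedCoefficient.fundamentalV_eq (h : IsBoundedCoefficient B ε) (c₁ c₂ z : ℂ)
    (x : ℝ) : fundamentalV x₀ ε c₁ c₂ z x =
      c₂ - z * ∫ t in x₀..x, fundamentalU x₀ ε c₁ c₂ z t := by
  rw [← (h.hasSum_integral_fundamentalU c₁ c₂ z x).tsum_eq, fundamentalV]

theorem IsBoundedCoefficient.continuous_fundamentalU (h : IsBoundedCoefficient B ε)
    (c₁ c₂ z : ℂ) : Continuous (fundamentalU x₀ ε c₁ c₂ z) := by
  refine continuous_iff_continuousAt.2 fun x => ?_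
  have h1 : ContinuousOn (fundamentalU x₀ ε c₁ c₂ z) (Metric.closedBall x₀ (|x - x₀| + 1)) :=
    continuousOn_tsum (fun k => ((h.continuous_volterra_iterate
      (h.continuous_leadingTerm c₁ c₂) k).const_mul _).continuousOn)
      (summable_exponential_bound _ _) fun k y hy => norm_neg_pow_mul_le
        (h.norm_iterate_leadingTerm_le c₁ c₂ (by simpa [Real.dist_eq] using hy)) le_rfl k
  refine h1.continuousAt (Metric.closedBall_mem_nhds_of_mem ?_)
  rw [Metric.mem_ball, Real.dist_eq]
  exact lt_add_one _

/-- Integrating the series termwise applies the Volterra operator once more to each term, which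
shifts the index by one. -/
theorem IsBoundedCoefficient.isVolterraSolution_fundamental (h : IsBoundedCoefficient B ε)
    (c₁ c₂ z : ℂ) :
    IsVolterraSolution x₀ ε z (fundamentalU x₀ ε c₁ c₂ z) (fundamentalV x₀ ε c₁ c₂ z) := by
  have hU := h.continuous_fundamentalU (x₀ := x₀) c₁ c₂ z
  have hV : Continuous (fundamentalV x₀ ε c₁ c₂ z) := by
    rw [funext (h.fundamentalV_eq c₁ c₂ z)]
    exact continuous_const.sub ((continuous_integral_of_continuous hU).const_mul z)
  have hit := fun k => h.continuous_volterra_iterate (x₀ := x₀)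
    (h.continuous_leadingTerm (x₀ := x₀) c₁ c₂) k
  have hu : ∀ x, fundamentalU x₀ ε c₁ c₂ z x =
      c₁ + ∫ t in x₀..x, ε t * fundamentalV x₀ ε c₁ c₂ z t := by
    intro x
    have hB := h.nonneg
    have h1 := intervalIntegral.hasSum_integral_of_dominated_convergence (a := x₀) (b := x)
      (μ := volume)
      (F := fun k t => (-z) ^ k *
        (ε t * ∫ s in x₀..t, (volterra x₀ ε)^[k] (leadingTerm x₀ ε c₁ c₂) s))
      (f := fun t => ε t * ∫ s in x₀..t, fundamentalU x₀ ε c₁ c₂ z s)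
      (fun k _ => (B * ((‖c₁‖ + B * ‖c₂‖ * |x - x₀|) * |x - x₀|)) *
        ((‖z‖ * (B * |x - x₀| * |x - x₀|)) ^ k / k.factorial))
      (fun k => ((h.aestronglyMeasurable.mul
        (continuous_integral_of_continuous (hit k)).aestronglyMeasurable).const_mul _).restrict)
      (fun k => ae_of_all _ fun t ht => norm_neg_pow_mul_le (α := fun k => ε t *
          ∫ s in x₀..t, (volterra x₀ ε)^[k] (leadingTerm x₀ ε c₁ c₂) s) (fun k => by
        rw [norm_mul]
        refine (mul_le_mul (h.norm_le t) (h.norm_integral_volterra_iterate_le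
          (h.norm_leadingTerm_le c₁ c₂ _) k (abs_sub_le_of_mem_uIoc ht))
          (norm_nonneg _) hB).trans (le_of_eq ?_)
        ring) le_rfl k)
      (ae_of_all _ fun t _ => summable_exponential_bound _ _)
      intervalIntegrable_const
      (ae_of_all _ fun t _ => by
        have := (h.hasSum_integral_fundamentalU (x₀ := x₀) c₁ c₂ z t).mul_left (ε t)
        refine this.congr_fun ?_
        intro k; ring)
    have h2 : ∀ k, ∫ t in x₀..x, (-z) ^ k *
        (ε t * ∫ s in x₀..t, (volterra x₀ ε)^[k] (leadingTerm x₀ ε c₁ c₂) s) =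
        (-z) ^ k * (volterra x₀ ε)^[k + 1] (leadingTerm x₀ ε c₁ c₂) x := by
      intro k
      rw [intervalIntegral.integral_const_mul, Function.iterate_succ_apply', volterra]
    simp only [h2] at h1
    -- Without its term k = 0, which is `leadingTerm`, the series of `fundamentalU` is -z times the
    -- series in `h1`.
    have h3 := (hasSum_nat_add_iff' 1).2 (h.hasSum_fundamentalU (x₀ := x₀) c₁ c₂ z x)
    have h4 := (h1.mul_left (-z)).unique (h3.congr_fun fun k => by ring)
    simp only [Finset.range_one, Finset.sum_singleton, pow_zero, one_mul,
      Function.iterate_zero, id_eq] at h4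
    have h5 : ∫ t in x₀..x, ε t * fundamentalV x₀ ε c₁ c₂ z t = (∫ t in x₀..x, ε t * c₂) -
        z * ∫ t in x₀..x, ε t * ∫ s in x₀..t, fundamentalU x₀ ε c₁ c₂ z s := by
      rw [← intervalIntegral.integral_const_mul, ← intervalIntegral.integral_sub
        (h.intervalIntegrable_mul continuous_const _ _) ((h.intervalIntegrable_mul
          (continuous_integral_of_continuous hU) _ _).const_mul z)]
      refine intervalIntegral.integral_congr fun t _ => ?_
      simp only [h.fundamentalV_eq c₁ c₂ z t]
      ring
    rw [h5]
    unfold leadingTerm at h4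
    linear_combination -h4
  have hu0 : fundamentalU x₀ ε c₁ c₂ z x₀ = c₁ := by rw [hu]; simp
  have hv0 : fundamentalV x₀ ε c₁ c₂ z x₀ = c₂ := by rw [h.fundamentalV_eq]; simp
  exact ⟨hU, hV, fun x => by rw [hu0]; exact hu x,
    fun x => by rw [hv0]; exact h.fundamentalV_eq c₁ c₂ z x⟩

theorem IsBoundedCoefficient.fundamentalV_self (h : IsBoundedCoefficient B ε) (c₁ c₂ z : ℂ) :
    fundamentalV x₀ ε c₁ c₂ z x₀ = c₂ := by
  rw [h.fundamentalV_eq]; simp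

theorem fundamentalU_self (c₁ c₂ z : ℂ) : fundamentalU x₀ ε c₁ c₂ z x₀ = c₁ := by
  rw [fundamentalU, tsum_eq_single 0]
  · simp [leadingTerm]
  · intro k hk
    obtain ⟨m, rfl⟩ := Nat.exists_eq_succ_of_ne_zero hk
    rw [Function.iterate_succ_apply', volterra]
    simp

theorem IsBoundedCoefficient.differentiable_fundamentalU (h : IsBoundedCoefficient B ε)
    (c₁ c₂ : ℂ) (x : ℝ) : Differentiable ℂ fun z => fundamentalU x₀ ε c₁ c₂ z x :=
  differentiable_tsum_neg_pow_mul (h.norm_iterate_leadingTerm_le c₁ c₂ (le_refl |x - x₀|))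

theorem IsBoundedCoefficient.differentiable_fundamentalV (h : IsBoundedCoefficient B ε)
    (c₁ c₂ : ℂ) (x : ℝ) : Differentiable ℂ fun z => fundamentalV x₀ ε c₁ c₂ z x :=
  (differentiable_const c₂).sub (differentiable_id.mul (differentiable_tsum_neg_pow_mul
    fun k => h.norm_integral_volterra_iterate_le
      (h.norm_leadingTerm_le c₁ c₂ _) k (le_refl |x - x₀|)))

/-! ### Continuous dependence on the coefficient and on z -/

section Convergence

variable {ι : Type*} {F : Filter ι} [F.IsCountablyGenerated] {e : ι → ℝ → ℂ}

/-- Pointwise convergence under the common bound B passes through both integrals by dominated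
convergence, which is why the filter has to be countably generated. -/
theorem tendsto_iterate_leadingTerm (hε : ∀ᶠ i in F, IsBoundedCoefficient B (e i))
    (he : ∀ x, Tendsto (fun i => e i x) F (𝓝 (ε x))) (c₁ c₂ : ℂ) (k : ℕ) :
    ∀ x, Tendsto (fun i => (volterra x₀ (e i))^[k] (leadingTerm x₀ (e i) c₁ c₂) x) F
      (𝓝 ((volterra x₀ ε)^[k] (leadingTerm x₀ ε c₁ c₂) x)) := by
  induction k with
  | zero =>
    intro x
    refine Tendsto.const_add _ (intervalIntegral.tendsto_integral_filter_of_dominated_convergence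
      (fun _ => B * ‖c₂‖) ?_ ?_ intervalIntegrable_const
      (ae_of_all _ fun t _ => (he t).mul_const c₂))
    · filter_upwards [hε] with i hi
      exact (hi.aestronglyMeasurable.mul_const c₂).restrict
    · filter_upwards [hε] with i hi
      refine ae_of_all _ fun t _ => ?_
      rw [norm_mul]
      exact mul_le_mul_of_nonneg_right (hi.norm_le t) (norm_nonneg _)
  | succ k ih =>
    have h1 : ∀ x, Tendsto
        (fun i => ∫ t in x₀..x, (volterra x₀ (e i))^[k] (leadingTerm x₀ (e i) c₁ c₂) t) F
        (𝓝 (∫ t in x₀..x, (volterra x₀ ε)^[k] (leadingTerm x₀ ε c₁ c₂) t)) := by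
      intro x
      refine intervalIntegral.tendsto_integral_filter_of_dominated_convergence
        (fun _ => (‖c₁‖ + B * ‖c₂‖ * |x - x₀|) * (B * |x - x₀| * |x - x₀|) ^ k / k.factorial)
        ?_ ?_ intervalIntegrable_const (ae_of_all _ fun t _ => ih t)
      · filter_upwards [hε] with i hi
        exact (hi.continuous_volterra_iterate
          (hi.continuous_leadingTerm c₁ c₂) k).aestronglyMeasurable
      · filter_upwards [hε] with i hi
        exact ae_of_all _ fun t ht =>
          hi.norm_iterate_leadingTerm_le c₁ c₂ (abs_sub_le_of_mem_uIoc ht) k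
    intro x
    simp only [Function.iterate_succ_apply']
    refine intervalIntegral.tendsto_integral_filter_of_dominated_convergence
      (fun _ => B * ((‖c₁‖ + B * ‖c₂‖ * |x - x₀|) * |x - x₀| *
        (B * |x - x₀| * |x - x₀|) ^ k / k.factorial))
      ?_ ?_ intervalIntegrable_const (ae_of_all _ fun t _ => (he t).mul (h1 t))
    · filter_upwards [hε] with i hi
      exact (hi.aestronglyMeasurable.mul (continuous_integral_of_continuous
        (hi.continuous_volterra_iterate
          (hi.continuous_leadingTerm c₁ c₂) k)).aestronglyMeasurable).restrict
    · filter_upwards [hε] with i hi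
      refine ae_of_all _ fun t ht => ?_
      rw [norm_mul]
      exact mul_le_mul (hi.norm_le t) (hi.norm_integral_volterra_iterate_le
        (hi.norm_leadingTerm_le c₁ c₂ _) k (abs_sub_le_of_mem_uIoc ht)) (norm_nonneg _) hi.nonneg

theorem tendsto_fundamentalU (hε : ∀ᶠ i in F, IsBoundedCoefficient B (e i))
    (he : ∀ x, Tendsto (fun i => e i x) F (𝓝 (ε x))) {w : ι → ℂ} {z : ℂ}
    (hw : Tendsto w F (𝓝 z)) (c₁ c₂ : ℂ) (x : ℝ) :
    Tendsto (fun i => fundamentalU x₀ (e i) c₁ c₂ (w i) x) F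
      (𝓝 (fundamentalU x₀ ε c₁ c₂ z x)) := by
  refine tendsto_tsum_neg_pow_mul (A := ‖c₁‖ + B * ‖c₂‖ * |x - x₀|) (C := B * |x - x₀| * |x - x₀|)
    (fun k => tendsto_iterate_leadingTerm hε he c₁ c₂ k x) ?_ hw
  filter_upwards [hε] with i hi k
  exact hi.norm_iterate_leadingTerm_le c₁ c₂ le_rfl k

theorem tendsto_fundamentalV (hε : ∀ᶠ i in F, IsBoundedCoefficient B (e i))
    (he : ∀ x, Tendsto (fun i => e i x) F (𝓝 (ε x))) {w : ι → ℂ} {z : ℂ}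
    (hw : Tendsto w F (𝓝 z)) (c₁ c₂ : ℂ) (x : ℝ) :
    Tendsto (fun i => fundamentalV x₀ (e i) c₁ c₂ (w i) x) F
      (𝓝 (fundamentalV x₀ ε c₁ c₂ z x)) := by
  refine Tendsto.const_sub _ (hw.mul (tendsto_tsum_neg_pow_mul
    (A := (‖c₁‖ + B * ‖c₂‖ * |x - x₀|) * |x - x₀|) (C := B * |x - x₀| * |x - x₀|)
    (fun k => ?_) ?_ hw))
  · refine intervalIntegral.tendsto_integral_filter_of_dominated_convergence
      (fun _ => (‖c₁‖ + B * ‖c₂‖ * |x - x₀|) * (B * |x - x₀| * |x - x₀|) ^ k / k.factorial)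
      ?_ ?_ intervalIntegrable_const
      (ae_of_all _ fun t _ => tendsto_iterate_leadingTerm hε he c₁ c₂ k t)
    · filter_upwards [hε] with i hi
      exact (hi.continuous_volterra_iterate
        (hi.continuous_leadingTerm c₁ c₂) k).aestronglyMeasurable
    · filter_upwards [hε] with i hi
      exact ae_of_all _ fun t ht =>
        hi.norm_iterate_leadingTerm_le c₁ c₂ (abs_sub_le_of_mem_uIoc ht) k
  · filter_upwards [hε] with i hi k
    exact hi.norm_integral_volterra_iterate_le (hi.norm_leadingTerm_le c₁ c₂ _) k le_rfl

end Convergence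

end Solutions

/-! ### Monodromy, discriminant and Bloch spectrum -/

section Monodromy

variable {μ₀ x₀ : ℝ} {ε : ℝ → ℂ} {ω : ℂ} {u v u₁ v₁ u₂ v₂ : ℝ → ℂ}

theorem IsSolution.linearCombination (h₁ : IsSolution μ₀ ε ω u₁ v₁)
    (h₂ : IsSolution μ₀ ε ω u₂ v₂) (c d : ℂ) :
    IsSolution μ₀ ε ω (fun x => c * u₁ x + d * u₂ x) (fun x => c * v₁ x + d * v₂ x) where
  continuous := (h₁.continuous.const_mul c).add (h₂.continuous.const_mul d)
  flux_continuous := (h₁.flux_continuous.const_mul c).add (h₂.flux_continuous.const_mul d)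
  hasDerivAt x hx := (((h₁.hasDerivAt x hx).const_mul c).add
    ((h₂.hasDerivAt x hx).const_mul d)).congr_deriv (by ring)
  flux_hasDerivAt x := (((h₁.flux_hasDerivAt x).const_mul c).add
    ((h₂.flux_hasDerivAt x).const_mul d)).congr_deriv (by ring)

theorem IsSolution.shift (h : IsSolution μ₀ ε ω u v) (hp : ∀ x, ε (x + 1) = ε x) :
    IsSolution μ₀ ε ω (fun x => u (x + 1)) (fun x => v (x + 1)) where
  continuous := h.continuous.comp (continuous_add_const 1)
  flux_continuous := h.flux_continuous.comp (continuous_add_const 1)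
  hasDerivAt x hx := by
    have h1 : ContinuousAt ε (x + 1) := by
      have h2 : ε = fun y => ε (y - 1) := by
        funext y
        rw [← hp (y - 1), sub_add_cancel]
      rw [h2]
      refine ContinuousAt.comp (f := fun y : ℝ => y - 1) ?_ (by fun_prop)
      simpa using hx
    have := (h.hasDerivAt (x + 1) h1).comp_add_const x 1
    rwa [hp] at this
  flux_hasDerivAt x := (h.flux_hasDerivAt (x + 1)).comp_add_const x 1

/-- The shift of a solution by a period, minus a multiple of it, is a solution. -/
theorem IsSolution.shift_sub (h : IsSolution μ₀ ε ω u v) (hp : ∀ x, ε (x + 1) = ε x) (c : ℂ) :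
    IsSolution μ₀ ε ω (fun x => u (x + 1) - c * u x) (fun x => v (x + 1) - c * v x) := by
  have := (h.shift hp).linearCombination h 1 (-c)
  simpa only [one_mul, neg_mul, ← sub_eq_add_neg] using this

theorem IsSolution.eq_zero_of_data (h : IsSolution μ₀ ε ω u v) (hε : IsPermittivity x₀ ε)
    (hu : u x₀ = 0) (hv : v x₀ = 0) : u = 0 ∧ v = 0 := by
  obtain ⟨B, hB⟩ := hε.exists_isBoundedCoefficient
  exact (hB.isVolterraSolution_iff.2 h).eq_zero hB hu hv

/-- At the continuity points of ε, which are dense, εv = u' = 0 and ε ≠ 0. Continuity of v does the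
rest. -/
theorem IsSolution.flux_eq_zero (h : IsSolution μ₀ ε ω u v) (hε : IsPermittivity x₀ ε)
    (hu : u = 0) : v = 0 := by
  subst hu
  have hd : Dense {x | ¬ContinuousAt ε x}ᶜ :=
    hε.piecewiseSmooth.countable_not_continuousAt.dense_compl ℝ
  refine h.flux_continuous.ext_on hd continuous_zero fun x hx => ?_
  have h1 := (h.hasDerivAt x (not_not.1 hx)).unique (hasDerivAt_const x (0 : ℂ))
  refine (mul_eq_zero.1 h1).resolve_left fun h0 => ?_
  have := hε.re_pos x
  rw [h0] at this
  simp at this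

/-- The derivative vanishes off a countable set. For the fundamental pair, comparing x₀ with x₀ + 1
gives det M = 1. -/
theorem IsSolution.wronskian_eq (h₁ : IsSolution μ₀ ε ω u₁ v₁) (h₂ : IsSolution μ₀ ε ω u₂ v₂)
    (hε : IsPermittivity x₀ ε) (x y : ℝ) :
    u₁ x * v₂ x - u₂ x * v₁ x = u₁ y * v₂ y - u₂ y * v₁ y := by
  have h := MeasureTheory.integral_eq_of_hasDerivAt_off_countable (a := y) (b := x)
    (fun t => u₁ t * v₂ t - u₂ t * v₁ t) (fun _ => 0)
    hε.piecewiseSmooth.countable_not_continuousAt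
    ((h₁.continuous.mul h₂.flux_continuous).sub
      (h₂.continuous.mul h₁.flux_continuous)).continuousOn
    (fun t ht => (((h₁.hasDerivAt t (not_not.1 ht.2)).mul (h₂.flux_hasDerivAt t)).sub
      ((h₂.hasDerivAt t (not_not.1 ht.2)).mul (h₁.flux_hasDerivAt t))).congr_deriv (by ring))
    intervalIntegrable_const
  simp only [intervalIntegral.integral_zero] at h
  linear_combination -h

theorem IsPermittivity.isSolution_fundamental (hε : IsPermittivity x₀ ε) (μ₀ : ℝ) (ω c₁ c₂ : ℂ) :
    IsSolution μ₀ ε ω (fundamentalU x₀ ε c₁ c₂ (μ₀ * ω ^ 2))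
      (fundamentalV x₀ ε c₁ c₂ (μ₀ * ω ^ 2)) := by
  obtain ⟨B, hB⟩ := hε.exists_isBoundedCoefficient
  exact hB.isVolterraSolution_iff.1 (hB.isVolterraSolution_fundamental c₁ c₂ _)

theorem IsPermittivity.fundamentalV_self (hε : IsPermittivity x₀ ε) (c₁ c₂ z : ℂ) :
    fundamentalV x₀ ε c₁ c₂ z x₀ = c₂ := by
  obtain ⟨B, hB⟩ := hε.exists_isBoundedCoefficient
  exact hB.fundamentalV_self c₁ c₂ z

theorem IsSolution.eq_fundamental (h : IsSolution μ₀ ε ω u v) (hε : IsPermittivity x₀ ε) (x : ℝ) :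
    u x = u x₀ * fundamentalU x₀ ε 1 0 (μ₀ * ω ^ 2) x
        + v x₀ * fundamentalU x₀ ε 0 1 (μ₀ * ω ^ 2) x ∧
      v x = u x₀ * fundamentalV x₀ ε 1 0 (μ₀ * ω ^ 2) x
        + v x₀ * fundamentalV x₀ ε 0 1 (μ₀ * ω ^ 2) x := by
  have h1 := ((hε.isSolution_fundamental μ₀ ω 1 0).linearCombination
    (hε.isSolution_fundamental μ₀ ω 0 1) (u x₀) (v x₀)).linearCombination h (-1) 1
  obtain ⟨hu, hv⟩ := h1.eq_zero_of_data hε (by simp [fundamentalU_self])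
    (by simp [hε.fundamentalV_self])
  have hu' := congrFun hu x
  have hv' := congrFun hv x
  simp only [Pi.zero_apply] at hu' hv'
  exact ⟨by linear_combination hu', by linear_combination hv'⟩

/-- The trace of the monodromy matrix, as a function of `z = μ₀ ω²`. -/
noncomputable def discriminant (x₀ : ℝ) (ε : ℝ → ℂ) (z : ℂ) : ℂ :=
  fundamentalU x₀ ε 1 0 z (x₀ + 1) + fundamentalV x₀ ε 0 1 z (x₀ + 1)

/-- The Cayley–Hamilton relation for the shift by a period. -/
theorem IsSolution.shift_shift (h : IsSolution μ₀ ε ω u v) (hε : IsPermittivity x₀ ε) (x : ℝ) :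
    u (x + 1 + 1) = discriminant x₀ ε (μ₀ * ω ^ 2) * u (x + 1) - u x ∧
      v (x + 1 + 1) = discriminant x₀ ε (μ₀ * ω ^ 2) * v (x + 1) - v x := by
  have hs := h.shift hε.periodic
  have h2 := (hs.shift hε.periodic).linearCombination
    (hs.linearCombination h (discriminant x₀ ε (μ₀ * ω ^ 2)) (-1)) 1 (-1)
  have hdet := (hε.isSolution_fundamental μ₀ ω 1 0).wronskian_eq
    (hε.isSolution_fundamental μ₀ ω 0 1) hε (x₀ + 1) x₀
  simp only [fundamentalU_self, hε.fundamentalV_self] at hdet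
  obtain ⟨e1, e2⟩ := h.eq_fundamental hε (x₀ + 1)
  obtain ⟨e3, e4⟩ := hs.eq_fundamental hε (x₀ + 1)
  obtain ⟨hu, hv⟩ := h2.eq_zero_of_data hε
    (by
      rw [e3, discriminant, e1, e2]
      linear_combination (-u x₀) * hdet)
    (by
      rw [e4, discriminant, e1, e2]
      linear_combination (-v x₀) * hdet)
  have hu' := congrFun hu x
  have hv' := congrFun hv x
  simp only [Pi.zero_apply] at hu' hv'
  exact ⟨by linear_combination hu', by linear_combination hv'⟩

/-- This is (M - ρ)(M - σ) = 0: subtracting σ times a solution from its shift leaves a solution with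
Floquet multiplier ρ. -/
theorem IsSolution.shift_shift_sub (h : IsSolution μ₀ ε ω u v) (hε : IsPermittivity x₀ ε)
    {ρ σ : ℂ} (hD : ρ + σ = discriminant x₀ ε (μ₀ * ω ^ 2)) (hρσ : ρ * σ = 1) (x : ℝ) :
    u (x + 1 + 1) - σ * u (x + 1) = ρ * (u (x + 1) - σ * u x) ∧
      v (x + 1 + 1) - σ * v (x + 1) = ρ * (v (x + 1) - σ * v x) := by
  obtain ⟨h1, h2⟩ := h.shift_shift hε x
  rw [h1, h2, ← hD]
  constructor
  · linear_combination (u x) * hρσ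
  · linear_combination (v x) * hρσ

/-- Multipliers of modulus one with product 1 are e^{iκ} and e^{-iκ}, with sum 2 cos κ. -/
theorem IsPermittivity.mem_blochSpectrum_iff (hε : IsPermittivity x₀ ε) :
    ω ∈ blochSpectrum μ₀ ε ↔
      ∃ t ∈ Icc (-2 : ℝ) 2, discriminant x₀ ε (μ₀ * ω ^ 2) = t := by
  constructor
  · rintro ⟨κ, -, u, v, hs, hne, hu, -⟩
    obtain ⟨x, hx⟩ := Function.ne_iff.1 hne
    refine ⟨2 * Real.cos κ, ⟨by linarith [Real.neg_one_le_cos κ], by linarith [Real.cos_le_one κ]⟩,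
      ?_⟩
    have h1 := (hs.shift_shift hε x).1
    rw [hu (x + 1), hu x] at h1
    have h2 : Complex.exp (Complex.I * κ) * Complex.exp (-(κ : ℂ) * Complex.I) = 1 := by
      rw [← Complex.exp_add, ← Complex.exp_zero]
      congr 1; ring
    have h3 : 2 * Complex.cos κ =
        Complex.exp (Complex.I * κ) + Complex.exp (-(κ : ℂ) * Complex.I) := by
      rw [Complex.cos, mul_comm Complex.I]; ring
    push_cast
    rw [h3]
    simp only [Pi.zero_apply] at hx
    refine mul_right_cancel₀ (mul_ne_zero (Complex.exp_ne_zero (Complex.I * κ)) hx) ?_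
    linear_combination -h1 - (u x) * h2
  · rintro ⟨t, ht, hD⟩
    set κ := Real.arccos (t / 2) with hκ
    have hcos : t = 2 * Real.cos κ := by
      rw [hκ, Real.cos_arccos (by linarith [ht.1]) (by linarith [ht.2])]; ring
    have hκ0 : 0 ≤ κ := Real.arccos_nonneg _
    have hκπ : κ ≤ Real.pi := Real.arccos_le_pi _
    have h2 : Complex.exp (Complex.I * κ) * Complex.exp (Complex.I * (-κ : ℝ)) = 1 := by
      rw [← Complex.exp_add, ← Complex.exp_zero]
      congr 1; push_cast; ring
    have h3 : Complex.exp (Complex.I * κ) + Complex.exp (Complex.I * (-κ : ℝ)) =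
        discriminant x₀ ε (μ₀ * ω ^ 2) := by
      rw [hD, hcos]
      push_cast
      rw [Complex.cos, mul_comm Complex.I, mul_comm Complex.I]; ring
    have hf := hε.isSolution_fundamental μ₀ ω 1 0
    set σ := Complex.exp (Complex.I * (-κ : ℝ))
    -- Either the fundamental solution already has multiplier σ = e^{-iκ}, or its image under M - σ
    -- is a non-zero solution with multiplier e^{iκ}.
    by_cases h0 : (fun x => fundamentalU x₀ ε 1 0 (μ₀ * ω ^ 2) (x + 1) -
        σ * fundamentalU x₀ ε 1 0 (μ₀ * ω ^ 2) x) = 0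
    · have h1 := (hf.shift_sub hε.periodic σ).flux_eq_zero hε h0
      refine ⟨-κ, ⟨by linarith, by linarith [Real.pi_pos]⟩, _, _, hf, ?_,
        fun x => sub_eq_zero.1 (congrFun h0 x), fun x => sub_eq_zero.1 (congrFun h1 x)⟩
      intro h
      have := congrFun h x₀
      rw [fundamentalU_self] at this
      exact one_ne_zero this
    · exact ⟨κ, ⟨by linarith [Real.pi_pos], hκπ⟩, _, _, hf.shift_sub hε.periodic σ, h0,
        fun x => (hf.shift_shift_sub hε h3 h2 x).1, fun x => (hf.shift_shift_sub hε h3 h2 x).2⟩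

end Monodromy

/-! ### Decaying solutions and the impedance quotient -/

section Decay

/-- Functions with Floquet multiplier `ρ` decay along `l`, those with multiplier `σ` do not. -/
structure IsDecayPair (l : Filter ℝ) (ρ σ : ℂ) : Prop where
  shift : Tendsto (fun x : ℝ => x + 1) l l
  tendsto_zero : ∀ f : ℝ → ℂ, (∀ x, f (x + 1) = ρ * f x) →
    (∃ C, ∀ x ∈ Icc (0 : ℝ) 1, ‖f x‖ ≤ C) → Tendsto f l (𝓝 0)
  eq_zero : ∀ f : ℝ → ℂ, (∀ x, f (x + 1) = σ * f x) → Tendsto f l (𝓝 0) → f = 0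

theorem apply_add_natCast_of_multiplier {f : ℝ → ℂ} {ρ : ℂ} (hf : ∀ x, f (x + 1) = ρ * f x) (x : ℝ)
    (n : ℕ) : f (x + n) = ρ ^ n * f x := by
  induction n with
  | zero => simp
  | succ n ih =>
    push_cast
    rw [← add_assoc, hf, ih, pow_succ']; ring

theorem tendsto_atTop_zero_of_multiplier {f : ℝ → ℂ} {ρ : ℂ} (hρ : ‖ρ‖ < 1)
    (hf : ∀ x, f (x + 1) = ρ * f x) {C : ℝ} (hC : ∀ x ∈ Icc (0 : ℝ) 1, ‖f x‖ ≤ C) :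
    Tendsto f atTop (𝓝 0) := by
  have h1 : Tendsto (fun x : ℝ => ‖ρ‖ ^ ⌊x⌋₊ * C) atTop (𝓝 0) := by
    have := ((tendsto_pow_atTop_nhds_zero_of_lt_one (norm_nonneg ρ) hρ).comp
      (tendsto_nat_floor_atTop (α := ℝ))).mul_const C
    simpa using this
  refine squeeze_zero_norm' ?_ h1
  filter_upwards [eventually_ge_atTop 0] with x hx
  have h2 := apply_add_natCast_of_multiplier hf (x - ⌊x⌋₊) ⌊x⌋₊
  rw [sub_add_cancel] at h2
  rw [h2, norm_mul, norm_pow]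
  gcongr
  refine hC _ ⟨sub_nonneg.2 (Nat.floor_le hx), ?_⟩
  linarith [Nat.lt_floor_add_one x]

theorem eq_zero_of_multiplier_of_tendsto_atTop {f : ℝ → ℂ} {σ : ℂ} (hσ : 1 ≤ ‖σ‖)
    (hf : ∀ x, f (x + 1) = σ * f x) (hl : Tendsto f atTop (𝓝 0)) : f = 0 := by
  funext x
  have h1 : Tendsto (fun n : ℕ => f (x + n)) atTop (𝓝 0) :=
    hl.comp (tendsto_atTop_add_const_left _ x tendsto_natCast_atTop_atTop)
  refine norm_le_zero_iff.1 (ge_of_tendsto' (by simpa using h1.norm) fun n => ?_)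
  rw [apply_add_natCast_of_multiplier hf, norm_mul, norm_pow]
  exact le_mul_of_one_le_left (norm_nonneg _) (one_le_pow₀ hσ)

theorem one_le_norm_of_mul_eq_one {ρ σ : ℂ} (hρ : ‖ρ‖ < 1) (h : ρ * σ = 1) : 1 ≤ ‖σ‖ := by
  have h1 := congrArg norm h
  rw [norm_mul, norm_one] at h1
  by_contra h2
  push Not at h2
  nlinarith [norm_nonneg ρ, norm_nonneg σ]

theorem isDecayPair_atTop {ρ σ : ℂ} (hρ : ‖ρ‖ < 1) (h : ρ * σ = 1) : IsDecayPair atTop ρ σ where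
  shift := tendsto_atTop_add_const_right _ 1 tendsto_id
  tendsto_zero _ hf := fun ⟨_, hC⟩ => tendsto_atTop_zero_of_multiplier hρ hf hC
  eq_zero _ hf hl :=
    eq_zero_of_multiplier_of_tendsto_atTop (one_le_norm_of_mul_eq_one hρ h) hf hl

/-- The reflection x ↦ 1 - x inverts multipliers and preserves [0, 1], so decay at -∞ reduces to
decay at +∞. -/
theorem reflect_multiplier {f : ℝ → ℂ} {ρ σ : ℂ} (h : ρ * σ = 1) (hf : ∀ x, f (x + 1) = σ * f x)
    (x : ℝ) : f (1 - (x + 1)) = ρ * f (1 - x) := by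
  have h1 := hf (1 - (x + 1))
  rw [show 1 - (x + 1) + 1 = 1 - x by ring] at h1
  rw [h1, ← mul_assoc, h, one_mul]

theorem isDecayPair_atBot {ρ σ : ℂ} (hρ : ‖ρ‖ < 1) (h : ρ * σ = 1) : IsDecayPair atBot σ ρ where
  shift := tendsto_atBot_add_const_right _ 1 tendsto_id
  tendsto_zero f hf := by
    rintro ⟨C, hC⟩
    have h1 := tendsto_atTop_zero_of_multiplier hρ (f := fun x => f (1 - x))
      (reflect_multiplier h hf) (C := C)
      (fun x hx => hC _ ⟨by linarith [hx.2], by linarith [hx.1]⟩)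
    have h2 := h1.comp (tendsto_atTop_add_const_left _ (1 : ℝ) tendsto_neg_atBot_atTop)
    refine h2.congr fun x => ?_
    simp
  eq_zero f hf hl := by
    have h1 := eq_zero_of_multiplier_of_tendsto_atTop (one_le_norm_of_mul_eq_one hρ h)
      (f := fun x => f (1 - x)) (reflect_multiplier (by rw [mul_comm]; exact h) hf)
      (hl.comp (tendsto_atBot_add_const_left _ (1 : ℝ) tendsto_neg_atTop_atBot))
    funext x
    have := congrFun h1 (1 - x)
    simpa using this

variable {μ₀ x₀ : ℝ} {ε : ℝ → ℂ} {ω ρ σ : ℂ} {l : Filter ℝ} {u v : ℝ → ℂ}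

/-- The difference u(x + 1) - ρ u(x) has multiplier σ and still decays along `l`, so it vanishes. -/
theorem IsDecayingSolution.multiplier (h : IsDecayingSolution μ₀ ε ω l u v)
    (hε : IsPermittivity x₀ ε) (hl : IsDecayPair l ρ σ)
    (hD : ρ + σ = discriminant x₀ ε (μ₀ * ω ^ 2)) (hρσ : ρ * σ = 1) (x : ℝ) :
    u (x + 1) = ρ * u x ∧ v (x + 1) = ρ * v x := by
  have hw := h.isSolution.shift_sub hε.periodic ρ
  have hu : (fun x => u (x + 1) - ρ * u x) = 0 := by
    refine hl.eq_zero _ (fun x => (h.isSolution.shift_shift_sub hε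
      (by rw [add_comm]; exact hD) (by rw [mul_comm]; exact hρσ) x).1) ?_
    have := (h.tendsto.comp hl.shift).sub (h.tendsto.const_mul ρ)
    simpa using this
  exact ⟨sub_eq_zero.1 (congrFun hu x), sub_eq_zero.1 (congrFun (hw.flux_eq_zero hε hu) x)⟩

theorem IsSolution.isDecayingSolution (h : IsSolution μ₀ ε ω u v) (hε : IsPermittivity x₀ ε)
    (hl : IsDecayPair l ρ σ) (hu : ∀ x, u (x + 1) = ρ * u x) (hv : ∀ x, v (x + 1) = ρ * v x)
    (hne : u ≠ 0) : IsDecayingSolution μ₀ ε ω l u v where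
  isSolution := h
  ne_zero := hne
  tendsto := hl.tendsto_zero u hu
    (isCompact_Icc.exists_bound_of_continuousOn h.continuous.continuousOn)
  deriv_tendsto := by
    obtain ⟨B, hB⟩ := hε.exists_isBoundedCoefficient
    obtain ⟨C, hC⟩ := (isCompact_Icc (a := (0 : ℝ)) (b := 1)).exists_bound_of_continuousOn
      h.flux_continuous.continuousOn
    refine hl.tendsto_zero _ (fun x => by rw [hε.periodic, hv]; ring) ⟨B * C, fun x hx => ?_⟩
    rw [norm_mul]
    exact mul_le_mul (hB.norm_le x) (hC x hx) (norm_nonneg _) hB.nonneg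

/-- The value at `x₀` of the `ρ`-Floquet solution obtained by applying `M - σ` to `(c₁, c₂)`. -/
noncomputable def floquetU (x₀ : ℝ) (ε : ℝ → ℂ) (c₁ c₂ z σ : ℂ) : ℂ :=
  fundamentalU x₀ ε c₁ c₂ z (x₀ + 1) - σ * c₁

/-- The flux at `x₀` of the `ρ`-Floquet solution obtained by applying `M - σ` to `(c₁, c₂)`. -/
noncomputable def floquetV (x₀ : ℝ) (ε : ℝ → ℂ) (c₁ c₂ z σ : ℂ) : ℂ :=
  fundamentalV x₀ ε c₁ c₂ z (x₀ + 1) - σ * c₂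

/-- All decaying solutions are proportional at x₀, so the ratio does not depend on the solution
picked in `decayingRatio`, and one explicit decaying solution computes it. -/
theorem IsPermittivity.impedance_of_floquetV_ne_zero (hε : IsPermittivity x₀ ε)
    (hl : IsDecayPair l ρ σ) (hD : ρ + σ = discriminant x₀ ε (μ₀ * ω ^ 2)) (hρσ : ρ * σ = 1)
    (hne : ρ ≠ σ) {c₁ c₂ : ℂ} (hq : floquetV x₀ ε c₁ c₂ (μ₀ * ω ^ 2) σ ≠ 0) :
    HasFiniteImpedance μ₀ x₀ ε l ω ∧ decayingRatio μ₀ x₀ ε l ω =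
      floquetU x₀ ε c₁ c₂ (μ₀ * ω ^ 2) σ / floquetV x₀ ε c₁ c₂ (μ₀ * ω ^ 2) σ := by
  have hf := hε.isSolution_fundamental μ₀ ω c₁ c₂
  have hw := hf.shift_sub hε.periodic σ
  set p := fun x => fundamentalU x₀ ε c₁ c₂ (μ₀ * ω ^ 2) (x + 1) -
    σ * fundamentalU x₀ ε c₁ c₂ (μ₀ * ω ^ 2) x with hp_def
  set q := fun x => fundamentalV x₀ ε c₁ c₂ (μ₀ * ω ^ 2) (x + 1) -
    σ * fundamentalV x₀ ε c₁ c₂ (μ₀ * ω ^ 2) x with hq_def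
  have hp0 : p x₀ = floquetU x₀ ε c₁ c₂ (μ₀ * ω ^ 2) σ := by
    simp only [hp_def, floquetU, fundamentalU_self]
  have hq0 : q x₀ = floquetV x₀ ε c₁ c₂ (μ₀ * ω ^ 2) σ := by
    simp only [hq_def, floquetV, hε.fundamentalV_self]
  rw [← hp0, ← hq0]
  rw [← hq0] at hq
  have hpm : ∀ x, p (x + 1) = ρ * p x := fun x => (hf.shift_shift_sub hε hD hρσ x).1
  have hqm : ∀ x, q (x + 1) = ρ * q x := fun x => (hf.shift_shift_sub hε hD hρσ x).2
  have hpne : p ≠ 0 := fun h0 => hq (congrFun (hw.flux_eq_zero hε h0) x₀)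
  have hdec : IsDecayingSolution μ₀ ε ω l p q := hw.isDecayingSolution hε hl hpm hqm hpne
  have key : ∀ u v : ℝ → ℂ, IsDecayingSolution μ₀ ε ω l u v →
      v x₀ ≠ 0 ∧ u x₀ / v x₀ = p x₀ / q x₀ := by
    intro u v huv
    have hm := huv.multiplier hε hl hD hρσ x₀
    have hwr := huv.isSolution.wronskian_eq hw hε (x₀ + 1) x₀
    change u (x₀ + 1) * q (x₀ + 1) - p (x₀ + 1) * v (x₀ + 1) =
      u x₀ * q x₀ - p x₀ * v x₀ at hwr
    rw [hm.1, hm.2, hpm, hqm] at hwr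
    have hW : u x₀ * q x₀ - p x₀ * v x₀ = 0 := by
      -- Over a period the Wronskian W of two solutions with multiplier ρ is multiplied by ρ², yet
      -- it is constant. Multiplying ρ²W = W by σ gives ρW = σW.
      have h1 : (ρ - σ) * (u x₀ * q x₀ - p x₀ * v x₀) = 0 := by
        linear_combination σ * hwr - (ρ * (u x₀ * q x₀ - p x₀ * v x₀)) * hρσ
      exact (mul_eq_zero.1 h1).resolve_left (sub_ne_zero.2 hne)
    have hv : v x₀ ≠ 0 := by
      intro hv
      rw [hv, mul_zero, sub_zero] at hW
      exact huv.ne_zero (huv.isSolution.eq_zero_of_data hε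
        ((mul_eq_zero.1 hW).resolve_right hq) hv).1
    exact ⟨hv, (div_eq_div_iff hv hq).2 (by linear_combination hW)⟩
  refine ⟨⟨⟨p, q, hdec⟩, fun u v huv => (key u v huv).1⟩, ?_⟩
  have hex : ∃ p : (ℝ → ℂ) × (ℝ → ℂ), IsDecayingSolution μ₀ ε ω l p.1 p.2 := ⟨(p, q), hdec⟩
  rw [decayingRatio, dif_pos hex]
  exact (key _ _ hex.choose_spec).2

/-- Otherwise M - σ, applied to a decaying solution, would give a decaying solution with zero flux
at x₀. It is non-zero, being ρ - σ times the original. -/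
theorem IsPermittivity.exists_floquetV_ne_zero (hε : IsPermittivity x₀ ε)
    (hl : IsDecayPair l ρ σ) (hD : ρ + σ = discriminant x₀ ε (μ₀ * ω ^ 2)) (hρσ : ρ * σ = 1)
    (hne : ρ ≠ σ) (hfin : HasFiniteImpedance μ₀ x₀ ε l ω) :
    ∃ c₁ c₂ : ℂ, floquetV x₀ ε c₁ c₂ (μ₀ * ω ^ 2) σ ≠ 0 := by
  by_contra! hall
  obtain ⟨⟨u, v, huv⟩, hv⟩ := hfin
  have h := huv.isSolution
  have hw := h.shift_sub hε.periodic σ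
  have hpm := fun x => (h.shift_shift_sub hε hD hρσ x).1
  have hqm := fun x => (h.shift_shift_sub hε hD hρσ x).2
  have hwne : (fun x => u (x + 1) - σ * u x) ≠ 0 := by
    intro h0
    obtain ⟨x, hx⟩ := Function.ne_iff.1 huv.ne_zero
    have h1 := sub_eq_zero.1 (congrFun h0 x)
    rw [(huv.multiplier hε hl hD hρσ x).1] at h1
    exact hne (mul_right_cancel₀ hx h1)
  refine hv _ _ (hw.isDecayingSolution hε hl hpm hqm hwne) ?_
  have h1 := hall (u x₀) (v x₀)
  have h2 := (hε.isSolution_fundamental μ₀ ω (u x₀) (v x₀)).eq_fundamental hε (x₀ + 1)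
  rw [fundamentalU_self, hε.fundamentalV_self, ← (h.eq_fundamental hε (x₀ + 1)).2] at h2
  rw [floquetV, h2.2] at h1
  exact h1

end Decay

/-! ### Holomorphic choice of the Floquet multipliers -/

section Multipliers

/-- The complex numbers outside the real segment `[-2, 2]`. -/
def offSegment : Set ℂ := {D | ¬∃ t ∈ Icc (-2 : ℝ) 2, D = t}

theorem isOpen_offSegment : IsOpen offSegment := by
  have h : offSegment = ((fun t : ℝ => (t : ℂ)) '' Icc (-2 : ℝ) 2)ᶜ := by
    ext D
    simp [offSegment, eq_comm]
  rw [h]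
  exact (isCompact_Icc.image Complex.continuous_ofReal).isClosed.isOpen_compl

/-- A holomorphic square root of `1 - 4 / D²` off the segment `[-2, 2]`. -/
noncomputable def joukowskiRoot (D : ℂ) : ℂ := Complex.exp (Complex.log (1 - 4 / D ^ 2) / 2)

/-- The root of `X² - D X + 1` of modulus less than one. -/
noncomputable def smallMultiplier (D : ℂ) : ℂ := D * (1 - joukowskiRoot D) / 2

/-- The root of `X² - D X + 1` of modulus greater than one. -/
noncomputable def largeMultiplier (D : ℂ) : ℂ := D * (1 + joukowskiRoot D) / 2

variable {D : ℂ}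

theorem ne_zero_of_mem_offSegment (hD : D ∈ offSegment) : D ≠ 0 := by
  rintro rfl
  exact hD ⟨0, by norm_num, by simp⟩

/-- If 1 - 4/D² = s ≤ 0, then D² = 4/(1 - s) lies in (0, 4], so D is real with |D| ≤ 2. Hence D
times the principal root of 1 - 4/D² is a holomorphic root of D² - 4 off the segment, whereas the
principal root of D² - 4 itself would jump across the imaginary axis. -/
theorem mem_slitPlane_of_mem_offSegment (hD : D ∈ offSegment) :
    1 - 4 / D ^ 2 ∈ Complex.slitPlane := by
  have hD0 := ne_zero_of_mem_offSegment hD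
  by_contra h
  rw [Complex.mem_slitPlane_iff_not_le_zero, not_not] at h
  obtain ⟨hre, him⟩ := Complex.le_def.1 h
  set s := (1 - 4 / D ^ 2).re with hs
  have h1 : 1 - 4 / D ^ 2 = (s : ℂ) := Complex.ext rfl (by simpa using him)
  have hs0 : s ≤ 0 := hre
  have h2 : D ^ 2 = ((4 / (1 - s) : ℝ) : ℂ) := by
    have h3 : (1 : ℂ) - s ≠ 0 := by
      have : (1 - s : ℝ) ≠ 0 := by linarith
      exact_mod_cast this
    push_cast
    rw [eq_div_iff h3, ← h1]
    field_simp
    ring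
  have h4 : 0 ≤ 4 / (1 - s) := div_nonneg (by norm_num) (by linarith)
  have h5 : Real.sqrt (4 / (1 - s)) ≤ 2 := by
    rw [Real.sqrt_le_left (by norm_num), div_le_iff₀ (by linarith)]
    linarith
  have h6 : D ^ 2 = ((Real.sqrt (4 / (1 - s)) : ℝ) : ℂ) ^ 2 := by
    rw [h2, ← Complex.ofReal_pow, Real.sq_sqrt h4]
  have h7 := Real.sqrt_nonneg (4 / (1 - s))
  rcases sq_eq_sq_iff_eq_or_eq_neg.1 h6 with h | h
  · exact hD ⟨_, ⟨by linarith, h5⟩, h⟩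
  · exact hD ⟨-Real.sqrt (4 / (1 - s)), ⟨by linarith, by linarith⟩, by rw [h]; simp⟩

theorem joukowskiRoot_sq (hD : D ∈ offSegment) : joukowskiRoot D ^ 2 = 1 - 4 / D ^ 2 := by
  rw [joukowskiRoot, ← Complex.exp_nat_mul]
  push_cast
  rw [mul_div_cancel₀ _ (two_ne_zero' ℂ),
    Complex.exp_log (Complex.slitPlane_ne_zero (mem_slitPlane_of_mem_offSegment hD))]

theorem joukowskiRoot_re_pos (hD : D ∈ offSegment) : 0 < (joukowskiRoot D).re := by
  have h := Complex.mem_slitPlane_iff_arg.1 (mem_slitPlane_of_mem_offSegment hD)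
  have h1 := Complex.arg_le_pi (1 - 4 / D ^ 2)
  have h2 := Complex.neg_pi_lt_arg (1 - 4 / D ^ 2)
  have h3 := lt_of_le_of_ne h1 h.1
  rw [joukowskiRoot, Complex.exp_re]
  refine mul_pos (Real.exp_pos _) (Real.cos_pos_of_mem_Ioo ?_)
  have h4 : (Complex.log (1 - 4 / D ^ 2) / 2).im = Complex.arg (1 - 4 / D ^ 2) / 2 := by
    rw [← Complex.log_im]
    exact Complex.div_ofNat_im _ 2
  rw [h4]
  constructor <;> linarith

theorem differentiableAt_joukowskiRoot (hD : D ∈ offSegment) :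
    DifferentiableAt ℂ joukowskiRoot D := by
  have h1 : DifferentiableAt ℂ (fun D : ℂ => 1 - 4 / D ^ 2) D :=
    (differentiableAt_const _).sub ((differentiableAt_const _).div (differentiableAt_id.pow 2)
      (pow_ne_zero 2 (ne_zero_of_mem_offSegment hD)))
  exact ((h1.clog (mem_slitPlane_of_mem_offSegment hD)).div_const 2).cexp

theorem smallMultiplier_add_large (D : ℂ) : smallMultiplier D + largeMultiplier D = D := by
  rw [smallMultiplier, largeMultiplier]; ring

theorem smallMultiplier_mul_large (hD : D ∈ offSegment) :
    smallMultiplier D * largeMultiplier D = 1 := by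
  have h := joukowskiRoot_sq hD
  have h0 := ne_zero_of_mem_offSegment hD
  have h1 : smallMultiplier D * largeMultiplier D = D ^ 2 * (1 - joukowskiRoot D ^ 2) / 4 := by
    rw [smallMultiplier, largeMultiplier]; ring
  rw [h1, h]
  field_simp
  ring

/-- A root with positive real part is closer to 1 than to -1, so the small multiplier has the
smaller modulus, and the product of the two is 1. -/
theorem norm_smallMultiplier_lt_one (hD : D ∈ offSegment) : ‖smallMultiplier D‖ < 1 := by
  have h1 := congrArg norm (smallMultiplier_mul_large hD)
  rw [norm_mul, norm_one] at h1
  have h2 : ‖1 - joukowskiRoot D‖ < ‖1 + joukowskiRoot D‖ := by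
    rw [← sq_lt_sq₀ (norm_nonneg _) (norm_nonneg _), ← Complex.normSq_eq_norm_sq,
      ← Complex.normSq_eq_norm_sq, Complex.normSq_apply, Complex.normSq_apply]
    simp only [Complex.sub_re, Complex.one_re, Complex.sub_im, Complex.one_im, Complex.add_re,
      Complex.add_im]
    nlinarith [joukowskiRoot_re_pos hD]
  have h3 : ‖smallMultiplier D‖ < ‖largeMultiplier D‖ := by
    rw [smallMultiplier, largeMultiplier, norm_div, norm_div, norm_mul, norm_mul]
    have := norm_pos_iff.2 (ne_zero_of_mem_offSegment hD)
    gcongr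
    simp
  nlinarith [norm_nonneg (smallMultiplier D), norm_nonneg (largeMultiplier D)]

/-- A choice of Floquet multipliers `ρ`, `σ` as functions of the discriminant, such that the
`ρ`-Floquet solutions decay along `l`. -/
structure IsMultiplierChoice (l : Filter ℝ) (ρ σ : ℂ → ℂ) : Prop where
  isDecayPair : ∀ D ∈ offSegment, IsDecayPair l (ρ D) (σ D)
  add_eq : ∀ D ∈ offSegment, ρ D + σ D = D
  mul_eq_one : ∀ D ∈ offSegment, ρ D * σ D = 1
  ne : ∀ D ∈ offSegment, ρ D ≠ σ D
  differentiableAt : ∀ D ∈ offSegment, DifferentiableAt ℂ σ D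

theorem smallMultiplier_ne_large (hD : D ∈ offSegment) :
    smallMultiplier D ≠ largeMultiplier D := by
  intro h
  have h1 := one_le_norm_of_mul_eq_one (norm_smallMultiplier_lt_one hD)
    (smallMultiplier_mul_large hD)
  rw [← h] at h1
  exact absurd h1 (not_le.2 (norm_smallMultiplier_lt_one hD))

theorem isMultiplierChoice_atTop :
    IsMultiplierChoice atTop smallMultiplier largeMultiplier where
  isDecayPair _ hD :=
    isDecayPair_atTop (norm_smallMultiplier_lt_one hD) (smallMultiplier_mul_large hD)
  add_eq D _ := smallMultiplier_add_large D
  mul_eq_one _ hD := smallMultiplier_mul_large hD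
  ne _ hD := smallMultiplier_ne_large hD
  differentiableAt _ hD := (differentiableAt_id.mul
    ((differentiableAt_joukowskiRoot hD).const_add 1)).div_const 2

theorem isMultiplierChoice_atBot :
    IsMultiplierChoice atBot largeMultiplier smallMultiplier where
  isDecayPair _ hD :=
    isDecayPair_atBot (norm_smallMultiplier_lt_one hD) (smallMultiplier_mul_large hD)
  add_eq D _ := by rw [add_comm]; exact smallMultiplier_add_large D
  mul_eq_one _ hD := by rw [mul_comm]; exact smallMultiplier_mul_large hD
  ne _ hD := (smallMultiplier_ne_large hD).symm
  differentiableAt _ hD := (differentiableAt_id.mul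
    ((differentiableAt_joukowskiRoot hD).const_sub 1)).div_const 2

end Multipliers

/-! ### Holomorphy and continuity of the impedance -/

section Impedance

variable {μ₀ x₀ : ℝ} {ε : ℝ → ℂ} {ω : ℂ} {l : Filter ℝ} {ρ σ : ℂ → ℂ} {c₁ c₂ : ℂ}

theorem IsPermittivity.notMem_blochSpectrum_iff (hε : IsPermittivity x₀ ε) :
    ω ∉ blochSpectrum μ₀ ε ↔ discriminant x₀ ε (μ₀ * ω ^ 2) ∈ offSegment :=
  not_congr hε.mem_blochSpectrum_iff

theorem IsPermittivity.differentiable_discriminant (hε : IsPermittivity x₀ ε) (μ₀ : ℝ) :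
    Differentiable ℂ fun ω : ℂ => discriminant x₀ ε (μ₀ * ω ^ 2) := by
  obtain ⟨B, hB⟩ := hε.exists_isBoundedCoefficient
  have h : Differentiable ℂ (discriminant x₀ ε) :=
    (hB.differentiable_fundamentalU 1 0 (x₀ + 1)).add (hB.differentiable_fundamentalV 0 1 (x₀ + 1))
  exact h.comp (by fun_prop : Differentiable ℂ fun ω : ℂ => (μ₀ : ℂ) * ω ^ 2)

theorem IsPermittivity.isOpen_compl_blochSpectrum (hε : IsPermittivity x₀ ε) (μ₀ : ℝ) :
    IsOpen (blochSpectrum μ₀ ε)ᶜ := by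
  have h : (blochSpectrum μ₀ ε)ᶜ =
      (fun ω : ℂ => discriminant x₀ ε (μ₀ * ω ^ 2)) ⁻¹' offSegment := by
    ext ω
    exact hε.notMem_blochSpectrum_iff
  rw [h]
  exact isOpen_offSegment.preimage (hε.differentiable_discriminant μ₀).continuous

theorem IsPermittivity.isOpen_of_isBandGap (hε : IsPermittivity x₀ ε) {G : Set ℂ}
    (hG : IsBandGap μ₀ ε G) : IsOpen G := by
  obtain ⟨ω, -, rfl⟩ := hG
  exact (hε.isOpen_compl_blochSpectrum μ₀).connectedComponentIn

/-- The frequency lies in a band gap and the impedance is finite and holomorphic there. -/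
structure IsRegularFrequency (μ₀ x₀ : ℝ) (ε : ℝ → ℂ) (l : Filter ℝ) (ω : ℂ) : Prop where
  notMem : ω ∉ blochSpectrum μ₀ ε
  finite : HasFiniteImpedance μ₀ x₀ ε l ω
  differentiableAt : DifferentiableAt ℂ (decayingRatio μ₀ x₀ ε l) ω

/-- With c₁ and c₂ fixed, the quotient formula persists in a neighbourhood of ω and exhibits the
impedance as a quotient of holomorphic functions. -/
theorem IsPermittivity.isRegularFrequency (hε : IsPermittivity x₀ ε)
    (hl : IsMultiplierChoice l ρ σ) (hD : discriminant x₀ ε (μ₀ * ω ^ 2) ∈ offSegment)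
    (hq : floquetV x₀ ε c₁ c₂ (μ₀ * ω ^ 2) (σ (discriminant x₀ ε (μ₀ * ω ^ 2))) ≠ 0) :
    IsRegularFrequency μ₀ x₀ ε l ω := by
  obtain ⟨B, hB⟩ := hε.exists_isBoundedCoefficient
  have hdisc := hε.differentiable_discriminant μ₀
  have hz : Differentiable ℂ fun ω : ℂ => (μ₀ : ℂ) * ω ^ 2 := by fun_prop
  have hσ : DifferentiableAt ℂ (fun ω : ℂ => σ (discriminant x₀ ε (μ₀ * ω ^ 2))) ω :=
    DifferentiableAt.comp ω (hl.differentiableAt _ hD) (hdisc ω)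
  have hU : DifferentiableAt ℂ (fun ω : ℂ => floquetU x₀ ε c₁ c₂ (μ₀ * ω ^ 2)
      (σ (discriminant x₀ ε (μ₀ * ω ^ 2)))) ω :=
    (((hB.differentiable_fundamentalU c₁ c₂ (x₀ + 1)).comp hz) ω).sub (hσ.mul_const c₁)
  have hV : DifferentiableAt ℂ (fun ω : ℂ => floquetV x₀ ε c₁ c₂ (μ₀ * ω ^ 2)
      (σ (discriminant x₀ ε (μ₀ * ω ^ 2)))) ω :=
    (((hB.differentiable_fundamentalV c₁ c₂ (x₀ + 1)).comp hz) ω).sub (hσ.mul_const c₂)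
  refine ⟨hε.notMem_blochSpectrum_iff.2 hD, (hε.impedance_of_floquetV_ne_zero
    (hl.isDecayPair _ hD) (hl.add_eq _ hD) (hl.mul_eq_one _ hD) (hl.ne _ hD) hq).1, ?_⟩
  refine (hU.fun_div hV hq).congr_of_eventuallyEq ?_
  filter_upwards [hdisc.continuous.continuousAt.preimage_mem_nhds (isOpen_offSegment.mem_nhds hD),
    hV.continuousAt.eventually_ne hq] with w hw hqw
  exact (hε.impedance_of_floquetV_ne_zero
    (hl.isDecayPair _ hw) (hl.add_eq _ hw) (hl.mul_eq_one _ hw) (hl.ne _ hw) hqw).2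

/-- The index carries both the coefficient and the frequency. A constant coefficient gives
regularity near ω, and the index (δ, w) gives the joint limit. The data c₁, c₂ are chosen at the
limit, where the denominator is non-zero, and serve for all nearby indices. -/
theorem IsPermittivity.eventually_isRegularFrequency {ι : Type*} {F : Filter ι}
    [F.IsCountablyGenerated] {e : ι → ℝ → ℂ} {w : ι → ℂ} {B : ℝ} (hε : IsPermittivity x₀ ε)
    (hl : IsMultiplierChoice l ρ σ) (hgap : ω ∉ blochSpectrum μ₀ ε)
    (hfin : HasFiniteImpedance μ₀ x₀ ε l ω) (hp : ∀ᶠ i in F, IsPermittivity x₀ (e i))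
    (hB : ∀ᶠ i in F, ∀ x, ‖e i x‖ ≤ B) (he : ∀ x, Tendsto (fun i => e i x) F (𝓝 (ε x)))
    (hw : Tendsto w F (𝓝 ω)) :
    (∀ᶠ i in F, IsRegularFrequency μ₀ x₀ (e i) l (w i)) ∧
      Tendsto (fun i => decayingRatio μ₀ x₀ (e i) l (w i)) F
        (𝓝 (decayingRatio μ₀ x₀ ε l ω)) := by
  have hc : ∀ᶠ i in F, IsBoundedCoefficient B (e i) := by
    filter_upwards [hp, hB] with i hi hi'
    have h := hi.piecewiseSmooth.countable_not_continuousAt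
    exact ⟨aestronglyMeasurable_of_countable_not_continuousAt h, hi', h⟩
  have hz : Tendsto (fun i => (μ₀ : ℂ) * w i ^ 2) F (𝓝 (μ₀ * ω ^ 2)) := (hw.pow 2).const_mul _
  have hD := hε.notMem_blochSpectrum_iff.1 hgap
  have hdisc : Tendsto (fun i => discriminant x₀ (e i) (μ₀ * w i ^ 2)) F
      (𝓝 (discriminant x₀ ε (μ₀ * ω ^ 2))) :=
    (tendsto_fundamentalU hc he hz 1 0 _).add (tendsto_fundamentalV hc he hz 0 1 _)
  have hσ := (hl.differentiableAt _ hD).continuousAt.tendsto.comp hdisc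
  obtain ⟨c₁, c₂, hq⟩ := hε.exists_floquetV_ne_zero (hl.isDecayPair _ hD) (hl.add_eq _ hD)
    (hl.mul_eq_one _ hD) (hl.ne _ hD) hfin
  have hU : Tendsto (fun i => floquetU x₀ (e i) c₁ c₂ (μ₀ * w i ^ 2)
      (σ (discriminant x₀ (e i) (μ₀ * w i ^ 2)))) F (𝓝 (floquetU x₀ ε c₁ c₂ (μ₀ * ω ^ 2)
      (σ (discriminant x₀ ε (μ₀ * ω ^ 2))))) :=
    (tendsto_fundamentalU hc he hz c₁ c₂ _).sub (hσ.mul_const c₁)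
  have hV : Tendsto (fun i => floquetV x₀ (e i) c₁ c₂ (μ₀ * w i ^ 2)
      (σ (discriminant x₀ (e i) (μ₀ * w i ^ 2)))) F (𝓝 (floquetV x₀ ε c₁ c₂ (μ₀ * ω ^ 2)
      (σ (discriminant x₀ ε (μ₀ * ω ^ 2))))) :=
    (tendsto_fundamentalV hc he hz c₁ c₂ _).sub (hσ.mul_const c₂)
  have hgood := (hp.and (hdisc.eventually (isOpen_offSegment.mem_nhds hD))).and
    (hV.eventually_ne hq)
  refine ⟨?_, ?_⟩
  · filter_upwards [hgood] with i hi
    exact hi.1.1.isRegularFrequency hl hi.1.2 hi.2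
  · rw [(hε.impedance_of_floquetV_ne_zero (hl.isDecayPair _ hD) (hl.add_eq _ hD)
      (hl.mul_eq_one _ hD) (hl.ne _ hD) hq).2]
    refine (hU.div hV hq).congr' ?_
    filter_upwards [hgood] with i hi
    exact (hi.1.1.impedance_of_floquetV_ne_zero (hl.isDecayPair _ hi.1.2) (hl.add_eq _ hi.1.2)
      (hl.mul_eq_one _ hi.1.2) (hl.ne _ hi.1.2) hi.2).2.symm

end Impedance

/-! ### Persistence of isolated zeros and selection of roots -/

section Roots

theorem IsCompact.eventually_forall_of_prod {ι X : Type*} [TopologicalSpace X] {F : Filter ι}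
    {K : Set X} (hK : IsCompact K) {P : ι → X → Prop}
    (hP : ∀ x ∈ K, ∀ᶠ p in F ×ˢ 𝓝 x, P p.1 p.2) : ∀ᶠ i in F, ∀ x ∈ K, P i x := by
  refine hK.induction_on (p := fun s => ∀ᶠ i in F, ∀ x ∈ s, P i x) (by simp) ?_ ?_ ?_
  · intro s t hst ht
    filter_upwards [ht] with i hi x hx using hi x (hst hx)
  · intro s t hs ht
    filter_upwards [hs, ht] with i hi hi' x hx
    exact hx.elim (hi x) (hi' x)
  · intro x hx
    obtain ⟨p, hp, q, hq, h⟩ := eventually_prod_iff.1 (hP x hx)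
    refine ⟨{y | q y}, mem_nhdsWithin_of_mem_nhds hq, ?_⟩
    filter_upwards [hp] with i hi y hy using h hi hy

/-- A form of Hurwitz's theorem: an isolated zero persists under locally uniform convergence. -/
theorem eventually_exists_zero_of_tendsto {ι : Type*} {F : Filter ι} {Z : ℂ → ℂ} {Y : ι → ℂ → ℂ}
    {a : ℂ} (hZ : AnalyticAt ℂ Z a) (ha : Z a = 0) (hne : ¬∀ᶠ w in 𝓝 a, Z w = 0)
    (hlim : ∀ᶠ w in 𝓝 a, Tendsto (fun p : ι × ℂ => Y p.1 p.2) (F ×ˢ 𝓝 w) (𝓝 (Z w)))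
    (hdiff : ∀ᶠ w in 𝓝 a, ∀ᶠ p : ι × ℂ in F ×ˢ 𝓝 w, DifferentiableAt ℂ (Y p.1) p.2)
    {r : ℝ} (hr : 0 < r) : ∀ᶠ i in F, ∃ w, dist w a < r ∧ Y i w = 0 := by
  have hiso := eventually_nhdsWithin_iff.1
    (hZ.eventually_eq_zero_or_eventually_ne_zero.resolve_left hne)
  obtain ⟨s, hs, hball⟩ := Metric.eventually_nhds_iff_ball.1
    ((hiso.and hZ.eventually_analyticAt).and (hlim.and hdiff))
  set t := min (s / 2) (r / 2) with ht_def
  have ht : 0 < t := lt_min (by linarith) (by linarith)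
  have hts : t < s := (min_le_left _ _).trans_lt (by linarith)
  have htr : t < r := (min_le_right _ _).trans_lt (by linarith)
  have hsub : ∀ w ∈ Metric.closedBall a t, w ∈ Metric.ball a s := fun w hw =>
    Metric.closedBall_subset_ball hts hw
  have hsphere : ∀ w ∈ Metric.sphere a t, w ∈ Metric.ball a s ∧ w ≠ a := fun w hw =>
    ⟨hsub w (Metric.sphere_subset_closedBall hw), Metric.ne_of_mem_sphere hw ht.ne'⟩
  -- The minimum m of |Z| on the circle is positive. Eventually |Y i| exceeds m/2 on the circle and
  -- is below m/2 at the centre.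
  obtain ⟨b, hb, hmin⟩ := (isCompact_sphere a t).exists_isMinOn
    (NormedSpace.sphere_nonempty.2 ht.le) (f := fun w => ‖Z w‖)
    (fun w hw => (hball w (hsphere w hw).1).1.2.continuousAt.norm.continuousWithinAt)
  set m := ‖Z b‖ with hm_def
  have hm : 0 < m := norm_pos_iff.2 ((hball b (hsphere b hb).1).1.1 (hsphere b hb).2)
  have h1 : ∀ᶠ i in F, ∀ w ∈ Metric.sphere a t, m / 2 < ‖Y i w‖ := by
    refine (isCompact_sphere a t).eventually_forall_of_prod fun w hw => ?_
    refine (hball w (hsphere w hw).1).2.1.norm.eventually (lt_mem_nhds ?_)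
    have : m ≤ ‖Z w‖ := hmin hw
    linarith
  have h2 : ∀ᶠ i in F, ∀ w ∈ Metric.closedBall a t, DifferentiableAt ℂ (Y i) w :=
    (isCompact_closedBall a t).eventually_forall_of_prod fun w hw => (hball w (hsub w hw)).2.2
  have h3 : ∀ᶠ i in F, ‖Y i a‖ < m / 2 := by
    have h4 := (hball a (Metric.mem_ball_self hs)).2.1.comp
      (tendsto_id.prodMk (tendsto_const_nhds (x := a)))
    rw [ha] at h4
    have h5 := h4.norm
    rw [norm_zero] at h5
    exact h5.eventually (gt_mem_nhds (by linarith))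
  filter_upwards [h1, h2, h3] with i hi1 hi2 hi3
  by_contra! hno
  have hno' : ∀ w ∈ Metric.closedBall a t, Y i w ≠ 0 := fun w hw =>
    hno w ((Metric.mem_closedBall.1 hw).trans_lt htr)
  -- Without a zero in the closed disc, 1/Y is holomorphic there, and the maximum principle bounds
  -- it at the centre by 2/m, contradicting `hi3`.
  have hd : DiffContOnCl ℂ (fun w => (Y i w)⁻¹) (Metric.ball a t) := by
    refine DifferentiableOn.diffContOnCl fun w hw => ?_
    rw [closure_ball a ht.ne'] at hw
    exact ((hi2 w hw).inv (hno' w hw)).differentiableWithinAt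
  have hle := Complex.norm_le_of_forall_mem_frontier_norm_le Metric.isBounded_ball hd
    (C := (m / 2)⁻¹) (fun w hw => by
      rw [frontier_ball a ht.ne'] at hw
      rw [norm_inv]
      exact inv_anti₀ (by linarith) (hi1 w hw).le)
    (subset_closure (Metric.mem_ball_self ht))
  rw [norm_inv] at hle
  have h6 := norm_pos_iff.2 (hno' a (Metric.mem_closedBall_self ht.le))
  have h7 := (inv_le_inv₀ h6 (by linarith)).1 hle
  linarith

/-- The hypothesis supplies a point for each radius separately. A single choice working for all
radii is a point whose distance to `a` is within δ of the infimum, since the infimum need not be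
attained. -/
theorem exists_tendsto_of_eventually_exists {P : ℝ → ℂ → Prop} {a : ℂ}
    (h : ∀ r > 0, ∀ᶠ δ in 𝓝[>] (0 : ℝ), ∃ w, dist w a < r ∧ P δ w) :
    ∃ f : ℝ → ℂ, (∀ᶠ δ in 𝓝[>] (0 : ℝ), P δ (f δ)) ∧ Tendsto f (𝓝[>] 0) (𝓝 a) := by
  have h1 : ∀ δ : ℝ, ∃ w, 0 < δ → (∃ w, P δ w) →
      P δ w ∧ ∀ w', P δ w' → dist w a < dist w' a + δ := by
    intro δ
    by_cases hδ : 0 < δ ∧ ∃ w, P δ w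
    · obtain ⟨hδ, w₀, hw₀⟩ := hδ
      have hbdd : BddBelow ((fun w => dist w a) '' {w | P δ w}) :=
        ⟨0, by rintro _ ⟨w, -, rfl⟩; exact dist_nonneg⟩
      obtain ⟨_, ⟨w, hw, rfl⟩, hlt⟩ := Real.lt_sInf_add_pos
        (s := (fun w => dist w a) '' {w | P δ w}) ⟨_, w₀, hw₀, rfl⟩ hδ
      refine ⟨w, fun _ _ => ⟨hw, fun w' hw' => hlt.trans_le ?_⟩⟩
      have := csInf_le hbdd ⟨w', hw', rfl⟩
      simp only at this
      linarith
    · exact ⟨a, fun h1 h2 => absurd ⟨h1, h2⟩ hδ⟩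
  choose f hf using h1
  refine ⟨f, ?_, Metric.tendsto_nhds.2 fun r hr => ?_⟩
  · filter_upwards [h 1 one_pos, self_mem_nhdsWithin] with δ hδ hδ0
    exact (hf δ hδ0 ⟨_, hδ.choose_spec.2⟩).1
  · filter_upwards [h (r / 2) (by linarith), self_mem_nhdsWithin,
      mem_nhdsWithin_of_mem_nhds (gt_mem_nhds (by linarith : (0 : ℝ) < r / 2))] with δ hδ hδ0 hδr
    obtain ⟨w, hw, hPw⟩ := hδ
    have := (hf δ hδ0 ⟨w, hPw⟩).2 w hPw
    have hδr' : δ < r / 2 := hδr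
    linarith

end Roots

/-! ### Perturbation of the damping and the main theorem -/

section Perturbation

variable {μ₀ x₀ : ℝ} {ε₁ : ℝ → ℂ} {ε₂ : ℝ → ℝ → ℂ} {ω : ℂ} {l : Filter ℝ} {ρ σ : ℂ → ℂ}

theorem tendstoUniformly_of_re_eq (hre : ∀ δ > 0, ∀ x, (ε₂ δ x).re = (ε₁ x).re)
    (him : TendstoUniformly (fun δ x => (ε₂ δ x).im) (fun x => (ε₁ x).im) (𝓝[>] (0 : ℝ))) :
    TendstoUniformly ε₂ ε₁ (𝓝[>] (0 : ℝ)) := by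
  rw [Metric.tendstoUniformly_iff] at him ⊢
  intro r hr
  filter_upwards [him r hr, self_mem_nhdsWithin] with δ hδ hδ0 x
  have h := hδ x
  rw [Real.dist_eq] at h
  rw [Complex.dist_of_re_eq (hre δ hδ0 x).symm, Real.dist_eq]
  exact h

theorem IsPermittivity.eventually_isRegularFrequency_nhds (hε : IsPermittivity x₀ ε₁)
    (hl : IsMultiplierChoice l ρ σ) (hgap : ω ∉ blochSpectrum μ₀ ε₁)
    (hfin : HasFiniteImpedance μ₀ x₀ ε₁ l ω) :
    ∀ᶠ w in 𝓝 ω, IsRegularFrequency μ₀ x₀ ε₁ l w := by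
  obtain ⟨B, hB⟩ := hε.exists_isBoundedCoefficient
  exact (hε.eventually_isRegularFrequency (e := fun _ => ε₁) (w := id) hl hgap hfin
    (Eventually.of_forall fun _ => hε) (Eventually.of_forall fun _ => hB.norm_le)
    (fun _ => tendsto_const_nhds) tendsto_id).1

theorem IsPermittivity.perturbation (hε : IsPermittivity x₀ ε₁)
    (hp : ∀ δ > 0, IsPermittivity x₀ (ε₂ δ)) (hu : TendstoUniformly ε₂ ε₁ (𝓝[>] (0 : ℝ)))
    (hl : IsMultiplierChoice l ρ σ) (hgap : ω ∉ blochSpectrum μ₀ ε₁)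
    (hfin : HasFiniteImpedance μ₀ x₀ ε₁ l ω) :
    (∀ᶠ p : ℝ × ℂ in 𝓝[>] (0 : ℝ) ×ˢ 𝓝 ω, IsRegularFrequency μ₀ x₀ (ε₂ p.1) l p.2) ∧
      Tendsto (fun p : ℝ × ℂ => decayingRatio μ₀ x₀ (ε₂ p.1) l p.2) (𝓝[>] (0 : ℝ) ×ˢ 𝓝 ω)
        (𝓝 (decayingRatio μ₀ x₀ ε₁ l ω)) := by
  obtain ⟨B, hB⟩ := hε.exists_isBoundedCoefficient
  -- Uniform convergence eventually puts `ε₂ δ` within distance 1 of `ε₁`, which gives the common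
  -- bound B + 1.
  refine hε.eventually_isRegularFrequency (e := fun p : ℝ × ℂ => ε₂ p.1) (w := Prod.snd)
    (B := B + 1) hl hgap hfin ?_ ?_ (fun x => (hu.tendsto_at x).comp tendsto_fst) tendsto_snd
  · have h : ∀ᶠ δ in 𝓝[>] (0 : ℝ), IsPermittivity x₀ (ε₂ δ) := by
      filter_upwards [self_mem_nhdsWithin] with δ hδ using hp δ hδ
    exact tendsto_fst.eventually h
  · have h : ∀ᶠ δ in 𝓝[>] (0 : ℝ), ∀ x, ‖ε₂ δ x‖ ≤ B + 1 := by
      filter_upwards [Metric.tendstoUniformly_iff.1 hu 1 one_pos] with δ hδ x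
      have h1 := hδ x
      rw [dist_eq_norm'] at h1
      calc ‖ε₂ δ x‖ = ‖ε₁ x + (ε₂ δ x - ε₁ x)‖ := by rw [add_sub_cancel]
        _ ≤ B + 1 := (norm_add_le _ _).trans (add_le_add (hB.norm_le x) h1.le)
    exact tendsto_fst.eventually h

end Perturbation

theorem corollary7p1 (μ₀ x₀ : ℝ) (hμ₀ : 0 < μ₀)
    -- the first system, and the second system with its parameter `δ > 0`
    (εA₁ εB₁ : ℝ → ℂ) (εA₂ εB₂ : ℝ → ℝ → ℂ)
    (hA₁ : IsPermittivity x₀ εA₁) (hB₁ : IsPermittivity x₀ εB₁)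
    (hA₂ : ∀ δ > 0, IsPermittivity x₀ (εA₂ δ)) (hB₂ : ∀ δ > 0, IsPermittivity x₀ (εB₂ δ))
    -- the systems differ only in their damping, and the dampings converge uniformly
    (hreA : ∀ δ > 0, ∀ x, (εA₂ δ x).re = (εA₁ x).re)
    (hreB : ∀ δ > 0, ∀ x, (εB₂ δ x).re = (εB₁ x).re)
    (himA : TendstoUniformly (fun δ x => (εA₂ δ x).im) (fun x => (εA₁ x).im) (𝓝[>] (0 : ℝ)))
    (himB : TendstoUniformly (fun δ x => (εB₂ δ x).im) (fun x => (εB₁ x).im) (𝓝[>] (0 : ℝ)))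
    -- a common band gap `GA ∩ GB` of the first system that contains a root of its impedance
    (GA GB : Set ℂ) (hGA : IsBandGap μ₀ εA₁ GA) (hGB : IsBandGap μ₀ εB₁ GB)
    (ω₁ : ℂ) (hω₁ : ω₁ ∈ GA ∩ GB) (hroot : IsImpedanceRoot μ₀ x₀ εA₁ εB₁ ω₁)
    -- the impedance does not vanish identically near the root
    (hne : ¬ ∀ᶠ ω in 𝓝 ω₁, IsImpedanceRoot μ₀ x₀ εA₁ εB₁ ω) :
    ∃ δ₀ > 0, ∃ ω₂ : ℝ → ℂ,
      (∀ δ ∈ Ioo 0 δ₀,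
        ω₂ δ ∈ GA ∩ GB ∧ IsImpedanceRoot μ₀ x₀ (εA₂ δ) (εB₂ δ) (ω₂ δ)) ∧
      Tendsto ω₂ (𝓝[>] 0) (𝓝 ω₁) := by
  have huA := tendstoUniformly_of_re_eq hreA himA
  have huB := tendstoUniformly_of_re_eq hreB himB
  have hregA := hA₁.eventually_isRegularFrequency_nhds isMultiplierChoice_atBot
    hroot.gapA hroot.finiteA
  have hregB := hB₁.eventually_isRegularFrequency_nhds isMultiplierChoice_atTop
    hroot.gapB hroot.finiteB
  have hpertA := hregA.mono fun w hw =>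
    hA₁.perturbation hA₂ huA isMultiplierChoice_atBot hw.notMem hw.finite
  have hpertB := hregB.mono fun w hw =>
    hB₁.perturbation hB₂ huB isMultiplierChoice_atTop hw.notMem hw.finite
  have hGopen : GA ∩ GB ∈ 𝓝 ω₁ :=
    ((hA₁.isOpen_of_isBandGap hGA).inter (hB₁.isOpen_of_isBandGap hGB)).mem_nhds hω₁
  have hanalytic : AnalyticAt ℂ (interfaceImpedance μ₀ x₀ εA₁ εB₁) ω₁ := by
    rw [Complex.analyticAt_iff_eventually_differentiableAt]
    filter_upwards [hregA, hregB] with w hwA hwB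
    exact hwA.differentiableAt.neg.add hwB.differentiableAt
  -- Near ω₁ every frequency is regular for both materials, so a zero of the impedance there is a
  -- genuine root and `hne` applies.
  have hne' : ¬∀ᶠ w in 𝓝 ω₁, interfaceImpedance μ₀ x₀ εA₁ εB₁ w = 0 := by
    refine fun h => hne ?_
    filter_upwards [h, hregA, hregB] with w hw hwA hwB
    exact ⟨hwA.notMem, hwB.notMem, hwA.finite, hwB.finite, hw⟩
  have hzero := fun {r : ℝ} (hr : 0 < r) => eventually_exists_zero_of_tendsto
    (F := 𝓝[>] (0 : ℝ)) (Y := fun δ => interfaceImpedance μ₀ x₀ (εA₂ δ) (εB₂ δ))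
    hanalytic hroot.eq_zero hne'
    (by
      filter_upwards [hpertA, hpertB] with w hwA hwB
      exact hwA.2.neg.add hwB.2)
    (by
      filter_upwards [hpertA, hpertB] with w hwA hwB
      filter_upwards [hwA.1, hwB.1] with p hpA hpB
      exact hpA.differentiableAt.neg.add hpB.differentiableAt) hr
  -- Splitting the product neighbourhoods gives a radius s, independent of δ, within which zeros are
  -- regular for both perturbed materials and stay in the original gaps.
  obtain ⟨pA, hpA, qA, hqA, hprodA⟩ := eventually_prod_iff.1 hpertA.self_of_nhds.1
  obtain ⟨pB, hpB, qB, hqB, hprodB⟩ := eventually_prod_iff.1 hpertB.self_of_nhds.1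
  obtain ⟨s, hs, hball⟩ := Metric.eventually_nhds_iff.1 ((hqA.and hqB).and hGopen)
  obtain ⟨ω₂, hω₂, hlim⟩ := exists_tendsto_of_eventually_exists
    (P := fun δ w => w ∈ GA ∩ GB ∧ IsImpedanceRoot μ₀ x₀ (εA₂ δ) (εB₂ δ) w) (a := ω₁)
    (fun r hr => by
      filter_upwards [hzero (lt_min hr hs), hpA, hpB] with δ hδ hδA hδB
      obtain ⟨w, hw, hw0⟩ := hδ
      obtain ⟨⟨hwA, hwB⟩, hwG⟩ := hball (hw.trans_le (min_le_right _ _))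
      have hA := hprodA hδA hwA
      have hB := hprodB hδB hwB
      exact ⟨w, hw.trans_le (min_le_left _ _), hwG,
        ⟨hA.notMem, hB.notMem, hA.finite, hB.finite, hw0⟩⟩)
  obtain ⟨δ₀, hδ₀, hsub⟩ := mem_nhdsGT_iff_exists_Ioo_subset.1 hω₂
  exact ⟨δ₀, hδ₀, ω₂, fun δ hδ => hsub hδ, hlim⟩
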